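/- Theorem 2.5. Fix $\sigma>0$ and $0\le p<1$. Let $X_1,X_2,\dots$ be i.i.d. with $X_i=Y_i+\sigma Z_i$ and $Y_i=U_iV_i$, where $Y_i$ and $Z_i$ are independent, $Z_i$ is standard normal, $U_i$ and $V_i$ are independent, $U_i\in\{0,1\}$ with $P(U_i=0)=p$, and $V_i$ has a probability density $f$ with characteristic function $\phi_f$. Let $\phi_w,\phi_k:\mathbb R\to\mathbb R$ be measurable functions (the Fourier transforms of the kernels $w,k$) and, for each $n$, let $h=h_n$, $g=g_n$ be bandwidths and $\epsilon_n$ a truncation level. Put $$\phi_{emp}(t)=\frac1n\sum_{j=1}^n e^{itX_j},\qquad p_{ng}=\frac g2\int_{-1/g}^{1/g}\frac{\phi_{emp}(t)\phi_k(gt)}{e^{-\sigma^2t^2/2}}\,dt,\qquad \hat p_{ng}=\min(p_{ng},1-\epsilon_n),$$ $$f^*_{nhg}(x)=\frac1{2\pi}\int_{-\infty}^{\infty}e^{-itx}\,\frac{\phi_{emp}(t)-\hat p_{ng}e^{-\sigma^2t^2/2}}{(1-\hat p_{ng})e^{-\sigma^2t^2/2}}\,\phi_w(ht)\,dt .$$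 Assume $E[X_1^2]<\infty$ and, for some real constants $A,B,C$, $\alpha\ge0$ and $\gamma>1+2\alpha$: 1. $|u|^\gamma\phi_f(u)$ is integrable over $\mathbb R$. 2. $\phi_w$ is bounded, real valued, symmetric, vanishes outside $[-1,1]$, $\phi_w(0)=1$, and $\phi_w(1-t)=At^\alpha+o(t^\alpha)$ as $t\downarrow0$. 3. $\phi_k$ is real valued, symmetric, integrable, vanishes outside $[-1,1]$, $\int\phi_k=2$, and $\phi_k(t)=Bt^\gamma+o(t^\gamma)$ and $\phi_k(1-t)=Ct^\alpha+o(t^\alpha)$ as $t\downarrow0$. 4. $h_n=\sigma((1+\eta_n)\log n)^{-1/2}$ and $g_n=\sigma((1+\delta_n)\log n)^{-1/2}$, where $\eta_n\downarrow0$, $\delta_n\downarrow0$, $\eta_n-\delta_n>0$, $(\eta_n-\delta_n)\log n\to\infty$, $-\eta_n\log n+(1+2\alpha)\log\log n\to\infty$ and $-\delta_n\log n+(1+2\alpha)\log\log n\to\infty$. 5. $0<\epsilon_n<1$, $\epsilon_n\downarrow0$ and $\dfrac{\log\epsilon_n}{(\eta_n-\delta_n)\log n}\to0$. (The pointwise and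 monotonicity requirements in 4 and 5 are needed only for all large $n$.) Then, for every $x\in\mathbb R$, $f^*_{nhg}(x)$ is integrable for all large $n$, and as $n\to\infty$ $$\frac{\sqrt n}{h^{1+2\alpha}e^{\sigma^2/(2h^2)}}\bigl(f^*_{nhg}(x)-E[f^*_{nhg}(x)]\bigr)\xrightarrow{\ \mathcal D\ }N\!\left(0,\ \frac{A^2}{2\pi^2(1-p)^2}\Bigl(\frac1{\sigma^2}\Bigr)^{2+2\alpha}\Gamma(\alpha+1)^2\right),$$ where $N(0,0)$ denotes the point mass at $0$ if $A=0$. -/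

import Mathlib

open MeasureTheory ProbabilityTheory Filter Topology Asymptotics

noncomputable section

/-! ### The observation model -/

/-- The law of a `{0, 1}`-valued random variable which vanishes with probability `p`. -/
def bernoulliZeroLaw (p : ℝ) : Measure ℝ :=
  ENNReal.ofReal p • Measure.dirac 0 + ENNReal.ofReal (1 - p) • Measure.dirac 1

/-- The law on `ℝ` with Lebesgue density `f`. -/
def densityLaw (f : ℝ → ℝ) : Measure ℝ :=
  volume.withDensity fun v => ENNReal.ofReal (f v)

/-- The observations are i.i.d. `X i = Y i + σ * Z i` with `Y i = U i * V i`; here `U i` vanishes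
with probability `p` and otherwise equals one, `V i` has density `f`, `Z i` is standard normal,
`U i` and `V i` are independent, and `Y i` and `Z i` are independent.
(The `X i` are identically distributed because these requirements determine their law.) -/
structure IsAtomicDeconvolutionSample {Ω : Type*} [MeasurableSpace Ω] (μ : Measure Ω)
    (p σ : ℝ) (f : ℝ → ℝ) (U V Z X : ℕ → Ω → ℝ) : Prop where
  law_U : ∀ i, HasLaw (U i) (bernoulliZeroLaw p) μ
  law_V : ∀ i, HasLaw (V i) (densityLaw f) μ
  law_Z : ∀ i, HasLaw (Z i) (gaussianReal 0 1) μ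
  indep_UV : ∀ i, IndepFun (U i) (V i) μ
  indep_YZ : ∀ i, IndepFun (fun ω => U i ω * V i ω) (Z i) μ
  obs_eq : ∀ i ω, X i ω = U i ω * V i ω + σ * Z i ω
  indep_X : iIndepFun X μ

/-! ### The estimators

The kernels `w` and `k` enter only through their Fourier transforms `φw` and `φk`, which are the
primary data below. -/

/-- The empirical characteristic function of the first `n` observations. -/
def empCharFun {Ω : Type*} (X : ℕ → Ω → ℝ) (n : ℕ) (ω : Ω) (t : ℝ) : ℂ :=
  (1 / (n : ℂ)) * ∑ j ∈ Finset.range n, Complex.exp (Complex.I * t * X j ω)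

/-- The complex integral that defines the preliminary estimator of `p`, with bandwidth `g`. -/
def pEstIntegral {Ω : Type*} (σ : ℝ) (φk : ℝ → ℝ) (X : ℕ → Ω → ℝ) (g : ℝ) (n : ℕ) (ω : Ω) : ℂ :=
  (g : ℂ) / 2 * ∫ t in (-(1 / g))..(1 / g),
    empCharFun X n ω t * (φk (g * t) : ℂ) / (Real.exp (-(σ ^ 2 * t ^ 2) / 2) : ℂ)

/-- The preliminary estimator of `p`: the integral above, which is a real number for even `φk`
(see `pEstIntegral_im`). -/
def pEst {Ω : Type*} (σ : ℝ) (φk : ℝ → ℝ) (X : ℕ → Ω → ℝ) (g : ℝ) (n : ℕ) (ω : Ω) : ℝ :=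
  (pEstIntegral σ φk X g n ω).re

/-- The truncated estimator of `p`. -/
def pEstTrunc {Ω : Type*} (σ : ℝ) (φk : ℝ → ℝ) (X : ℕ → Ω → ℝ) (g ε : ℝ) (n : ℕ) (ω : Ω) : ℝ :=
  min (pEst σ φk X g n ω) (1 - ε)

/-- The inversion integral that defines the estimator of the density at `x`, with bandwidth `h`
and with the value `q` in place of the parameter `p`. -/
def densityEstIntegral {Ω : Type*} (σ : ℝ) (φw : ℝ → ℝ) (X : ℕ → Ω → ℝ) (h q : ℝ) (n : ℕ)
    (x : ℝ) (ω : Ω) : ℂ :=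
  1 / (2 * (Real.pi : ℂ)) * ∫ t : ℝ,
    Complex.exp (-Complex.I * t * x) *
      ((empCharFun X n ω t - (q : ℂ) * (Real.exp (-(σ ^ 2 * t ^ 2) / 2) : ℂ)) /
        ((1 - (q : ℂ)) * (Real.exp (-(σ ^ 2 * t ^ 2) / 2) : ℂ))) * (φw (h * t) : ℂ)

/-- The plug-in estimator of the density at `x`: the inversion integral with the truncated
estimator of `p`. It is a real number for even `φw` (see `densityEstIntegral_im`). -/
def plugInDensityEst {Ω : Type*} (σ : ℝ) (φw φk : ℝ → ℝ) (X : ℕ → Ω → ℝ) (h g ε : ℝ) (n : ℕ)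
    (x : ℝ) (ω : Ω) : ℝ :=
  (densityEstIntegral σ φw X h (pEstTrunc σ φk X g ε n ω) n x ω).re

theorem empCharFun_conj {Ω : Type*} (X : ℕ → Ω → ℝ) (n : ℕ) (ω : Ω) (t : ℝ) :
    (starRingEnd ℂ) (empCharFun X n ω t) = empCharFun X n ω (-t) := by
  simp [empCharFun, ← Complex.exp_conj]

theorem pEstIntegral_im {Ω : Type*} (σ : ℝ) (φk : ℝ → ℝ) (hφk : ∀ t, φk (-t) = φk t)
    (X : ℕ → Ω → ℝ) (g : ℝ) (n : ℕ) (ω : Ω) : (pEstIntegral σ φk X g n ω).im = 0 := by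
  rw [← Complex.conj_eq_iff_im]
  unfold pEstIntegral
  rw [map_mul, ← intervalIntegral.intervalIntegral_conj]
  congr 1
  · simp [map_ofNat]
  · have key := intervalIntegral.integral_comp_neg (a := -(1 / g)) (b := 1 / g) fun t : ℝ =>
      empCharFun X n ω t * (φk (g * t) : ℂ) / (Real.exp (-(σ ^ 2 * t ^ 2) / 2) : ℂ)
    rw [neg_neg] at key
    rw [← key]
    congr 1
    funext t
    simp [empCharFun_conj, hφk, Complex.conj_ofReal, map_ofNat, ← Complex.exp_conj]

theorem densityEstIntegral_im {Ω : Type*} (σ : ℝ) (φw : ℝ → ℝ) (hφw : ∀ t, φw (-t) = φw t)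
    (X : ℕ → Ω → ℝ) (h q : ℝ) (n : ℕ) (x : ℝ) (ω : Ω) :
    (densityEstIntegral σ φw X h q n x ω).im = 0 := by
  rw [← Complex.conj_eq_iff_im]
  unfold densityEstIntegral
  rw [map_mul, ← integral_conj]
  congr 1
  · simp [map_ofNat]
  · rw [← integral_neg_eq_self]
    congr 1
    funext t
    simp [empCharFun_conj, hφw, Complex.conj_ofReal, map_ofNat, ← Complex.exp_conj]

/-! ### The conditions -/

/-- `u n ↓ 0`; as everywhere below, only large `n` matter. -/
def DecreasesToZero (u : ℕ → ℝ) : Prop :=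
  (∀ᶠ n in atTop, u (n + 1) ≤ u n) ∧ Tendsto u atTop (𝓝 0)

/-- The function `u ↦ |u| ^ γ * φ_f u` is integrable, where `γ > 0` and `φ_f` is the
characteristic function of the law with density `f`. -/
structure DensityCondition (f : ℝ → ℝ) (γ : ℝ) : Prop where
  gamma_pos : 0 < γ
  integrable : Integrable fun u : ℝ => ((|u| ^ γ : ℝ) : ℂ) * charFun (densityLaw f) u

/-- The condition on the Fourier transform `φw` of the kernel `w`. -/
structure KernelConditionW (φw : ℝ → ℝ) (A α γ : ℝ) : Prop where
  measurable : Measurable φw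
  bounded : ∃ M, ∀ t, |φw t| ≤ M
  symm : ∀ t, φw (-t) = φw t
  support_subset : Function.support φw ⊆ Set.Icc (-1) 1
  at_zero : φw 0 = 1
  alpha_nonneg : 0 ≤ α
  at_one : (fun t : ℝ => φw (1 - t) - A * t ^ α) =o[𝓝[>] 0] fun t : ℝ => t ^ α
  gamma_gt : 1 + 2 * α < γ

/-- The condition on the Fourier transform `φk` of the kernel `k`. -/
structure KernelConditionK (φk : ℝ → ℝ) (B C α γ : ℝ) : Prop where
  measurable : Measurable φk
  symm : ∀ t, φk (-t) = φk t
  support_subset : Function.support φk ⊆ Set.Icc (-1) 1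
  integrable : Integrable φk
  integral_eq : ∫ t, φk t = 2
  near_zero : (fun t : ℝ => φk t - B * t ^ γ) =o[𝓝[>] 0] fun t : ℝ => t ^ γ
  at_one : (fun t : ℝ => φk (1 - t) - C * t ^ α) =o[𝓝[>] 0] fun t : ℝ => t ^ α

/-- The bandwidth `σ * ((1 + η n) * log n) ^ (-1/2)`. -/
def bandwidth (σ : ℝ) (η : ℕ → ℝ) (n : ℕ) : ℝ :=
  σ * ((1 + η n) * Real.log n) ^ (-(1 / 2) : ℝ)

/-- The condition on the sequences `η` and `δ` which define the bandwidths `h` and `g`. -/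
structure BandwidthCondition (η δ : ℕ → ℝ) (α : ℝ) : Prop where
  eta_decr : DecreasesToZero η
  delta_decr : DecreasesToZero δ
  delta_lt_eta : ∀ᶠ n in atTop, 0 < η n - δ n
  diff_log : Tendsto (fun n : ℕ => (η n - δ n) * Real.log n) atTop atTop
  eta_log : Tendsto (fun n : ℕ => -η n * Real.log n + (1 + 2 * α) * Real.log (Real.log n))
    atTop atTop
  delta_log : Tendsto (fun n : ℕ => -δ n * Real.log n + (1 + 2 * α) * Real.log (Real.log n))
    atTop atTop

/-- The condition on the truncation sequence `ε`. -/
structure TruncationCondition (ε η δ : ℕ → ℝ) : Prop where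
  mem_Ioo : ∀ᶠ n in atTop, 0 < ε n ∧ ε n < 1
  decr : DecreasesToZero ε
  log_ratio : Tendsto (fun n : ℕ => Real.log (ε n) / ((η n - δ n) * Real.log n)) atTop (𝓝 0)

end

/-! ### Laplace-type asymptotics at the endpoint `1` -/

section Laplace

variable {φ : ℝ → ℝ} {A α : ℝ}

/-! Rescaling frequencies to `[0, 1]` turns both estimators into sample averages of `cosLaplace φ l
θ`, with `l = σ² / bandwidth²`. Writing `S` for `deconvAverage` and `W` for the deterministic
`scaledKernel`, the density estimator is `(S - W) / (1 - p̂) + W`, where `p̂` is the truncated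
estimator of `p`; so `p̂` enters only through one factor.

As `l → ∞` the weight `exp (l s² / 2)` concentrates at `s = 1`. Laplace's method (`tendsto_laplace`)
gives `N * cosLaplace φ l 0 → A Γ(α + 1)` for `N = l ^ (1 + α) * exp (-l / 2)`. The factor `cos (s
θ)` can be frozen at `cos θ`, with an error smaller by an order `|θ| / l` (`abs_cosLaplace_sub_le`).
For `θ = (X - x) / h` this is of order `h |X - x|`, negligible in L² because `X` has a second
moment.

What remains is a normalized sum of centred variables `cos ((X_j - x) / h)` with a convergent
coefficient. They are bounded, and their variance tends to `1 / 2` because the characteristic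
function of `X` vanishes at infinity. The central limit theorem for bounded rows then applies,
whatever the growth of the frequency `1 / h`.

It remains to replace `p̂` by the mean `m` of the untruncated estimator. The Gaussian factor in the
law of `X` cancels the weight, so `m → p` by the Riemann–Lebesgue lemma
(`tendsto_integral_cosLaplace`). Since `m` is deterministic, centring removes the bias. The error is
at most `|p_ng - m| |S - W| / (ε (1 - m))`, where `p_ng` is `pEst`, and Cauchy–Schwarz bounds its
mean. The condition on `η - δ` makes the fluctuation of `p_ng` so much smaller than that of `S` that
even the factor `1 / ε` is absorbed (`tendsto_scale_ratio`). -/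

theorem tendsto_div_rpow_of_isLittleO
    (hone : (fun t : ℝ => φ (1 - t) - A * t ^ α) =o[𝓝[>] 0] fun t : ℝ => t ^ α) :
    Tendsto (fun t : ℝ => φ (1 - t) / t ^ α) (𝓝[>] 0) (𝓝 A) := by
  have h1 := (hone.tendsto_div_nhds_zero).add_const A
  rw [zero_add] at h1
  refine h1.congr' ?_
  filter_upwards [self_mem_nhdsWithin] with t ht
  have : t ^ α ≠ 0 := (Real.rpow_pos_of_pos ht α).ne'
  field_simp
  ring

theorem exists_abs_le_rpow_of_isLittleO
    (hone : (fun t : ℝ => φ (1 - t) - A * t ^ α) =o[𝓝[>] 0] fun t : ℝ => t ^ α) :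
    ∃ κ : ℝ, 0 < κ ∧ κ < 1 ∧ ∀ t, 0 < t → t ≤ κ → |φ (1 - t)| ≤ (|A| + 1) * t ^ α := by
  have h1 := (tendsto_div_rpow_of_isLittleO hone).abs.eventually_le_const
    (show |A| < |A| + 1 by linarith)
  obtain ⟨κ, hκ, hsub⟩ := mem_nhdsGT_iff_exists_Ioo_subset.1 h1
  refine ⟨min (κ / 2) (1 / 2), ?_, ?_, fun t ht htκ => ?_⟩
  · have : (0 : ℝ) < κ := hκ
    positivity
  · exact (min_le_right _ _).trans_lt (by norm_num)
  · have hκ' : (0 : ℝ) < κ := hκ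
    have h2 : |φ (1 - t) / t ^ α| ≤ |A| + 1 :=
      hsub ⟨ht, by linarith [htκ.trans (min_le_left _ _)]⟩
    rwa [abs_div, abs_of_pos (Real.rpow_pos_of_pos ht α), div_le_iff₀ (Real.rpow_pos_of_pos ht α)]
      at h2

theorem tendsto_laplace_tail (α : ℝ) {κ : ℝ} (hκ0 : 0 < κ) (hκ1 : κ < 1)
    (hint : IntervalIntegrable φ volume 0 1) :
    Tendsto (fun l : ℝ => l ^ (1 + α) * Real.exp (-l / 2) *
      ∫ t in κ..1, φ (1 - t) * Real.exp (l * (1 - t) ^ 2 / 2)) atTop (𝓝 0) := by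
  have hint' : IntervalIntegrable (fun t => φ (1 - t)) volume κ 1 := by
    have := (hint.comp_sub_left 1).symm
    rw [sub_zero, sub_self] at this
    refine this.mono_set ?_
    rw [Set.uIcc_of_le hκ1.le, Set.uIcc_of_le zero_le_one]
    exact Set.Icc_subset_Icc_left hκ0.le
  -- On `[κ, 1]` the weight is at most `exp (l (1 - κ)² / 2)`, so after multiplication by `exp (-l /
  -- 2)` a decay `exp (-b l)` is left to beat the power of `l`.
  set b : ℝ := (1 - (1 - κ) ^ 2) / 2 with hb
  have hb0 : 0 < b := by rw [hb]; nlinarith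
  have h1 := (tendsto_rpow_mul_exp_neg_mul_atTop_nhds_zero (1 + α) b hb0).mul_const
    (∫ t in κ..1, |φ (1 - t)|)
  rw [zero_mul] at h1
  refine squeeze_zero_norm' ?_ h1
  filter_upwards [eventually_gt_atTop 0] with l hl
  rw [norm_mul, Real.norm_of_nonneg (by positivity), mul_assoc, mul_assoc]
  refine mul_le_mul_of_nonneg_left ?_ (by positivity)
  have h2 : ‖∫ t in κ..1, φ (1 - t) * Real.exp (l * (1 - t) ^ 2 / 2)‖ ≤
      ∫ t in κ..1, |φ (1 - t)| * Real.exp (l * (1 - κ) ^ 2 / 2) := by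
    refine intervalIntegral.norm_integral_le_of_norm_le hκ1.le ?_ (hint'.abs.mul_const _)
    refine ae_of_all _ fun t ht => ?_
    rw [norm_mul, Real.norm_eq_abs, Real.norm_of_nonneg (Real.exp_pos _).le]
    have : (1 - t) ^ 2 ≤ (1 - κ) ^ 2 := by nlinarith [ht.1, ht.2]
    gcongr
  rw [intervalIntegral.integral_mul_const] at h2
  refine (mul_le_mul_of_nonneg_left h2 (Real.exp_pos _).le).trans (le_of_eq ?_)
  rw [mul_left_comm, ← Real.exp_add, mul_comm]
  congr 2
  rw [hb]; ring

theorem tendsto_laplace_head (hα : 0 ≤ α) (hmeas : Measurable φ) {κ : ℝ} (hκ0 : 0 < κ)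
    (hκ1 : κ < 1) (hκ : ∀ t, 0 < t → t ≤ κ → |φ (1 - t)| ≤ (|A| + 1) * t ^ α)
    (hone : (fun t : ℝ => φ (1 - t) - A * t ^ α) =o[𝓝[>] 0] fun t : ℝ => t ^ α) :
    Tendsto (fun l : ℝ => l ^ (1 + α) * Real.exp (-l / 2) *
      ∫ t in (0 : ℝ)..κ, φ (1 - t) * Real.exp (l * (1 - t) ^ 2 / 2)) atTop
      (𝓝 (A * Real.Gamma (α + 1))) := by
  -- Substitute `t = u / l`: since `l (1 - u / l)² / 2 = l / 2 - u + u² / (2 l)`, the factor `exp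
  -- (-l / 2)` cancels. One power of `l` pays for `dt`, and `l ^ α` normalizes `φ (1 - u / l)`.
  set F : ℝ → ℝ → ℝ := fun l => (Set.Iic (κ * l)).indicator fun u =>
    l ^ α * φ (1 - u / l) * Real.exp (-u + u ^ 2 / (2 * l)) with hF
  have hlim : Tendsto (fun l : ℝ => ∫ u in Set.Ioi (0 : ℝ), F l u) atTop
      (𝓝 (∫ u in Set.Ioi (0 : ℝ), A * (Real.exp (-u) * u ^ α))) := by
    refine tendsto_integral_filter_of_dominated_convergence
      -- On the support `u ≤ κ l < l`, so `u² / (2 l) ≤ u / 2` and half of the exponential decay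
      -- survives. The exponent `(1 : ℝ)` is the shape expected by
      -- `integrableOn_rpow_mul_exp_neg_mul_rpow`.
      (fun u => (|A| + 1) * (u ^ α * Real.exp (-(1 / 2) * u ^ (1 : ℝ)))) ?_ ?_ ?_ ?_
    · refine Eventually.of_forall fun l => ?_
      refine (Measurable.indicator ?_ measurableSet_Iic).aestronglyMeasurable
      fun_prop
    · filter_upwards [eventually_gt_atTop 0] with l hl
      refine (ae_restrict_iff' measurableSet_Ioi).2 (ae_of_all _ fun u (hu : 0 < u) => ?_)
      have hpos : 0 ≤ (|A| + 1) * (u ^ α * Real.exp (-(1 / 2) * u ^ (1 : ℝ))) := by positivity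
      by_cases hul : u ≤ κ * l
      · rw [hF]
        simp only [Set.indicator_of_mem (show u ∈ Set.Iic (κ * l) from hul)]
        rw [norm_mul, norm_mul, Real.norm_of_nonneg (Real.rpow_nonneg hl.le α),
          Real.norm_of_nonneg (Real.exp_pos _).le, Real.norm_eq_abs]
        have h1 := hκ (u / l) (by positivity) ((div_le_iff₀ hl).2 hul)
        have h2 : l ^ α * |φ (1 - u / l)| ≤ (|A| + 1) * u ^ α := by
          refine (mul_le_mul_of_nonneg_left h1 (by positivity)).trans (le_of_eq ?_)
          rw [Real.div_rpow hu.le hl.le]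
          field_simp
        have h3 : -u + u ^ 2 / (2 * l) ≤ -(1 / 2) * u ^ (1 : ℝ) := by
          rw [Real.rpow_one]
          have : u ^ 2 / (2 * l) ≤ u / 2 := by
            rw [div_le_div_iff₀ (by positivity) two_pos]
            nlinarith
          linarith
        rw [← mul_assoc]
        gcongr
      · rw [hF]
        simp only [Set.indicator_of_notMem (show u ∉ Set.Iic (κ * l) from hul), norm_zero]
        exact hpos
    · exact (integrableOn_rpow_mul_exp_neg_mul_rpow (by linarith) one_pos
        (by norm_num)).const_mul _
    · refine (ae_restrict_iff' measurableSet_Ioi).2 (ae_of_all _ fun u (hu : 0 < u) => ?_)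
      have hdiv : Tendsto (fun l : ℝ => u / l) atTop (𝓝[>] 0) := by
        refine tendsto_nhdsWithin_iff.2 ⟨tendsto_const_nhds.div_atTop tendsto_id, ?_⟩
        filter_upwards [eventually_gt_atTop 0] with l hl
        exact div_pos hu hl
      have h1 := (tendsto_div_rpow_of_isLittleO hone).comp hdiv
      have h2 : Tendsto (fun l : ℝ => Real.exp (-u + u ^ 2 / (2 * l))) atTop
          (𝓝 (Real.exp (-u + 0))) := by
        refine (Real.continuous_exp.tendsto _).comp (tendsto_const_nhds.add ?_)
        exact tendsto_const_nhds.div_atTop (tendsto_id.const_mul_atTop two_pos)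
      rw [add_zero] at h2
      have h3 := (h1.mul_const (u ^ α)).mul h2
      rw [mul_assoc, mul_comm (u ^ α)] at h3
      refine h3.congr' ?_
      filter_upwards [eventually_gt_atTop 0, eventually_ge_atTop (u / κ)] with l hl hul
      have hul' : u ∈ Set.Iic (κ * l) := by
        rw [Set.mem_Iic, mul_comm]
        exact (div_le_iff₀ hκ0).1 hul
      rw [hF]
      simp only [Set.indicator_of_mem hul', Function.comp]
      rw [Real.div_rpow hu.le hl.le]
      field_simp
  rw [integral_const_mul] at hlim
  have hG : Real.Gamma (α + 1) = ∫ u in Set.Ioi (0 : ℝ), Real.exp (-u) * u ^ α := by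
    rw [Real.Gamma_eq_integral (by linarith)]
    simp
  rw [← hG] at hlim
  refine hlim.congr' ?_
  filter_upwards [eventually_gt_atTop 0] with l hl
  have hsub := intervalIntegral.integral_comp_div (a := 0) (b := κ * l)
    (fun t => φ (1 - t) * Real.exp (l * (1 - t) ^ 2 / 2)) hl.ne'
  rw [zero_div, mul_div_cancel_right₀ _ hl.ne', smul_eq_mul] at hsub
  rw [Real.rpow_add hl, Real.rpow_one,
    show ∀ a b c d : ℝ, a * b * c * d = b * c * (a * d) by intros; ring, ← hsub,
    intervalIntegral.integral_of_le (by positivity), ← integral_const_mul, hF]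
  simp only
  rw [integral_indicator measurableSet_Iic, Measure.restrict_restrict measurableSet_Iic,
    show Set.Iic (κ * l) ∩ Set.Ioi 0 = Set.Ioc 0 (κ * l) by ext; simp [and_comm]]
  congr 1
  funext u
  rw [show ∀ a b c d : ℝ, a * b * (c * d) = a * c * (b * d) by intros; ring, ← Real.exp_add]
  congr 2
  field_simp
  ring

/-- Only a neighbourhood of the endpoint `s = 1` contributes: the head yields the Gamma integral and
the tail is exponentially smaller. -/
theorem tendsto_laplace (hα : 0 ≤ α) (hmeas : Measurable φ)
    (hint : IntervalIntegrable φ volume 0 1)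
    (hone : (fun t : ℝ => φ (1 - t) - A * t ^ α) =o[𝓝[>] 0] fun t : ℝ => t ^ α) :
    Tendsto (fun l : ℝ => l ^ (1 + α) * Real.exp (-l / 2) *
      ∫ s in (0 : ℝ)..1, φ s * Real.exp (l * s ^ 2 / 2)) atTop
      (𝓝 (A * Real.Gamma (α + 1))) := by
  obtain ⟨κ, hκ0, hκ1, hκ⟩ := exists_abs_le_rpow_of_isLittleO hone
  have h := (tendsto_laplace_head hα hmeas hκ0 hκ1 hκ hone).add
    (tendsto_laplace_tail α hκ0 hκ1 hint)
  rw [add_zero] at h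
  refine h.congr fun l => ?_
  have hI : IntervalIntegrable (fun t => φ (1 - t) * Real.exp (l * (1 - t) ^ 2 / 2))
      volume 0 1 := by
    have := (hint.comp_sub_left 1).symm
    rw [sub_zero, sub_self] at this
    exact this.mul_continuousOn (by fun_prop)
  rw [← mul_add, intervalIntegral.integral_add_adjacent_intervals]
  · have := intervalIntegral.integral_comp_sub_left (a := 0) (b := 1)
      (fun s => φ s * Real.exp (l * s ^ 2 / 2)) 1
    rw [this]
    simp
  · refine hI.mono_set ?_
    rw [Set.uIcc_of_le hκ0.le, Set.uIcc_of_le zero_le_one]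
    exact Set.Icc_subset_Icc_right hκ1.le
  · refine hI.mono_set ?_
    rw [Set.uIcc_of_le hκ1.le, Set.uIcc_of_le zero_le_one]
    exact Set.Icc_subset_Icc_left hκ0.le

theorem isLittleO_abs_of_isLittleO
    (hone : (fun t : ℝ => φ (1 - t) - A * t ^ α) =o[𝓝[>] 0] fun t : ℝ => t ^ α) :
    (fun t : ℝ => |φ (1 - t)| - |A| * t ^ α) =o[𝓝[>] 0] fun t : ℝ => t ^ α := by
  refine IsBigO.trans_isLittleO (IsBigO.of_bound 1 ?_) hone
  filter_upwards [self_mem_nhdsWithin] with t (ht : 0 < t)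
  have h1 : |A| * t ^ α = |A * t ^ α| := by rw [abs_mul, abs_of_pos (Real.rpow_pos_of_pos ht α)]
  rw [h1, one_mul]
  exact abs_abs_sub_abs_le _ _

/-- A factor `1 - s` raises the order of vanishing at `s = 1` from `α` to `α + 1`, which costs the
Laplace integral a factor of order `1 / l`. The unsimplified `1 - (1 - t)` is `1 - s` at `s = 1 -
t`. -/
theorem isLittleO_mul_one_sub_of_isLittleO
    (hone : (fun t : ℝ => φ (1 - t) - A * t ^ α) =o[𝓝[>] 0] fun t : ℝ => t ^ α) :
    (fun t : ℝ => φ (1 - t) * (1 - (1 - t)) - A * t ^ (α + 1)) =o[𝓝[>] 0]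
      fun t : ℝ => t ^ (α + 1) := by
  refine (hone.mul_isBigO (isBigO_refl (fun t : ℝ => t) _)).congr' ?_ ?_
  · filter_upwards [self_mem_nhdsWithin] with t (ht : 0 < t)
    rw [Real.rpow_add ht, Real.rpow_one]
    ring
  · filter_upwards [self_mem_nhdsWithin] with t (ht : 0 < t)
    rw [Real.rpow_add ht, Real.rpow_one]

end Laplace

/-! ### The truncated cosine transform with a Gaussian weight -/

/-- The integral `∫₀¹ cos (s θ) φ(s) exp (l s² / 2) ds`. -/
noncomputable def cosLaplace (φ : ℝ → ℝ) (l θ : ℝ) : ℝ :=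
  ∫ s in (0 : ℝ)..1, Real.cos (s * θ) * φ s * Real.exp (l * s ^ 2 / 2)

section CosLaplace

variable {φ : ℝ → ℝ}

theorem intervalIntegrable_cosLaplace (hint : IntervalIntegrable φ volume 0 1) (l θ : ℝ) :
    IntervalIntegrable (fun s => Real.cos (s * θ) * φ s * Real.exp (l * s ^ 2 / 2))
      volume 0 1 :=
  (hint.continuousOn_mul (by fun_prop)).mul_continuousOn (by fun_prop)

theorem cosLaplace_zero (φ : ℝ → ℝ) (l : ℝ) :
    cosLaplace φ l 0 = ∫ s in (0 : ℝ)..1, φ s * Real.exp (l * s ^ 2 / 2) := by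
  simp [cosLaplace]

theorem abs_cosLaplace_le (hint : IntervalIntegrable φ volume 0 1) (l θ : ℝ) :
    |cosLaplace φ l θ| ≤ cosLaplace (fun s => |φ s|) l 0 := by
  rw [cosLaplace_zero, ← Real.norm_eq_abs]
  refine intervalIntegral.norm_integral_le_of_norm_le zero_le_one ?_
    (hint.abs.mul_continuousOn (by fun_prop))
  refine ae_of_all _ fun s _ => ?_
  rw [norm_mul, norm_mul, Real.norm_eq_abs, Real.norm_eq_abs,
    Real.norm_of_nonneg (Real.exp_pos _).le]
  have := Real.abs_cos_le_one (s * θ)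
  have h0 := abs_nonneg (φ s)
  gcongr
  nlinarith

theorem cosLaplace_abs_nonneg (φ : ℝ → ℝ) (l : ℝ) : 0 ≤ cosLaplace (fun s => |φ s|) l 0 := by
  rw [cosLaplace_zero]
  exact intervalIntegral.integral_nonneg zero_le_one fun s _ => by positivity

theorem abs_cos_sub_cos_le (a b : ℝ) : |Real.cos a - Real.cos b| ≤ |a - b| := by
  have := Real.lipschitzWith_cos.dist_le_mul a b
  simpa [Real.dist_eq] using this

/-- Cosine is 1-Lipschitz, so freezing `s θ` at `θ` costs `|θ| (1 - s)`, which is small exactly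
where the exponential weight is large. -/
theorem abs_cosLaplace_sub_le (hint : IntervalIntegrable φ volume 0 1) (l θ : ℝ) :
    |cosLaplace φ l θ - Real.cos θ * cosLaplace φ l 0| ≤
      |θ| * cosLaplace (fun s => |φ s| * (1 - s)) l 0 := by
  rw [cosLaplace_zero, cosLaplace_zero, cosLaplace, ← intervalIntegral.integral_const_mul,
    ← intervalIntegral.integral_const_mul, ← intervalIntegral.integral_sub
      (intervalIntegrable_cosLaplace hint l θ)
      ((hint.mul_continuousOn (by fun_prop)).const_mul _), ← Real.norm_eq_abs]
  refine intervalIntegral.norm_integral_le_of_norm_le zero_le_one ?_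
    (((hint.abs.mul_continuousOn (by fun_prop)).mul_continuousOn (by fun_prop)).const_mul _)
  refine ae_of_all _ fun s hs => ?_
  rw [← mul_assoc, ← sub_mul, ← sub_mul, norm_mul, norm_mul, Real.norm_eq_abs, Real.norm_eq_abs,
    Real.norm_of_nonneg (Real.exp_pos _).le]
  have h1 := abs_cos_sub_cos_le (s * θ) θ
  have h2 : |s * θ - θ| = |θ| * (1 - s) := by
    rw [show s * θ - θ = -(θ * (1 - s)) by ring, abs_neg, abs_mul,
      abs_of_nonneg (show (0 : ℝ) ≤ 1 - s by linarith [hs.2])]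
  rw [h2] at h1
  calc |Real.cos (s * θ) - Real.cos θ| * |φ s| * Real.exp (l * s ^ 2 / 2)
      ≤ |θ| * (1 - s) * |φ s| * Real.exp (l * s ^ 2 / 2) := by gcongr
    _ = |θ| * (|φ s| * (1 - s) * Real.exp (l * s ^ 2 / 2)) := by ring

theorem measurable_cosLaplace (hmeas : Measurable φ) (l : ℝ) : Measurable (cosLaplace φ l) := by
  have : StronglyMeasurable fun θ : ℝ => ∫ s in Set.Ioc (0 : ℝ) 1,
      Real.cos (s * θ) * φ s * Real.exp (l * s ^ 2 / 2) := by
    refine StronglyMeasurable.integral_prod_right'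
      (f := fun q : ℝ × ℝ => Real.cos (q.2 * q.1) * φ q.2 * Real.exp (l * q.2 ^ 2 / 2)) ?_
    exact Measurable.stronglyMeasurable (by fun_prop)
  have heq : cosLaplace φ l = fun θ : ℝ => ∫ s in Set.Ioc (0 : ℝ) 1,
      Real.cos (s * θ) * φ s * Real.exp (l * s ^ 2 / 2) :=
    funext fun θ => intervalIntegral.integral_of_le zero_le_one
  rw [heq]
  exact this.measurable

variable {A α : ℝ}

theorem tendsto_cosLaplace (hα : 0 ≤ α) (hmeas : Measurable φ)
    (hint : IntervalIntegrable φ volume 0 1)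
    (hone : (fun t : ℝ => φ (1 - t) - A * t ^ α) =o[𝓝[>] 0] fun t : ℝ => t ^ α) :
    Tendsto (fun l : ℝ => l ^ (1 + α) * Real.exp (-l / 2) * cosLaplace φ l 0) atTop
      (𝓝 (A * Real.Gamma (α + 1))) := by
  simp only [cosLaplace_zero]
  exact tendsto_laplace hα hmeas hint hone

theorem tendsto_cosLaplace_abs (hα : 0 ≤ α) (hmeas : Measurable φ)
    (hint : IntervalIntegrable φ volume 0 1)
    (hone : (fun t : ℝ => φ (1 - t) - A * t ^ α) =o[𝓝[>] 0] fun t : ℝ => t ^ α) :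
    Tendsto (fun l : ℝ => l ^ (1 + α) * Real.exp (-l / 2) * cosLaplace (fun s => |φ s|) l 0) atTop
      (𝓝 (|A| * Real.Gamma (α + 1))) :=
  tendsto_cosLaplace hα (by fun_prop) hint.abs (isLittleO_abs_of_isLittleO hone)

theorem tendsto_cosLaplace_abs_mul_one_sub (hα : 0 ≤ α) (hmeas : Measurable φ)
    (hint : IntervalIntegrable φ volume 0 1)
    (hone : (fun t : ℝ => φ (1 - t) - A * t ^ α) =o[𝓝[>] 0] fun t : ℝ => t ^ α) :
    Tendsto (fun l : ℝ => l ^ (1 + (α + 1)) * Real.exp (-l / 2) *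
      cosLaplace (fun s => |φ s| * (1 - s)) l 0) atTop
      (𝓝 (|A| * Real.Gamma (α + 1 + 1))) :=
  tendsto_cosLaplace (by linarith) (by fun_prop) (hint.abs.mul_continuousOn (by fun_prop))
    (isLittleO_mul_one_sub_of_isLittleO (φ := fun s => |φ s|) (isLittleO_abs_of_isLittleO hone))

end CosLaplace

/-! ### A central limit theorem for bounded triangular arrays -/

section CentralLimit

variable {Ω : Type*} [MeasurableSpace Ω] {μ : Measure Ω} [IsProbabilityMeasure μ]

/-- Second-order Taylor expansion of the exponential under the integral: centring kills the linear
term, and boundedness makes the cubic remainder explicit and uniform over rows. -/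
theorem norm_charFun_sub_quadratic_le {ξ : Ω → ℝ} (hξ : AEMeasurable ξ μ) {M : ℝ}
    (hM : ∀ ω, |ξ ω| ≤ M) (h0 : ∫ ω, ξ ω ∂μ = 0) (s : ℝ) :
    ‖charFun (μ.map ξ) s - (1 - ((s ^ 2 * ∫ ω, ξ ω ^ 2 ∂μ) / 2 : ℝ))‖ ≤
      (|s| * M) ^ 3 * Real.exp (|s| * M) := by
  have hbd : ∀ ω, ‖((s * ξ ω : ℝ) : ℂ) * Complex.I‖ ≤ |s| * M := fun ω => by
    rw [norm_mul, Complex.norm_I, mul_one, Complex.norm_real, norm_mul, Real.norm_eq_abs,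
      Real.norm_eq_abs]
    exact mul_le_mul_of_nonneg_left (hM ω) (abs_nonneg s)
  have hint1 : Integrable ξ μ := Integrable.of_bound hξ.aestronglyMeasurable M (ae_of_all _ hM)
  have hint2 : Integrable (fun ω => ξ ω ^ 2) μ :=
    Integrable.of_bound (by fun_prop) (M ^ 2) (ae_of_all _ fun ω => by
      rw [norm_pow, Real.norm_eq_abs]
      exact pow_le_pow_left₀ (abs_nonneg _) (hM ω) 2)
  have hintE : Integrable (fun ω => Complex.exp (((s * ξ ω : ℝ) : ℂ) * Complex.I)) μ :=
    Integrable.of_bound (by fun_prop) 1 (ae_of_all _ fun ω => by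
      rw [Complex.norm_exp_ofReal_mul_I])
  have hintQ : Integrable (fun ω => ∑ m ∈ Finset.range 3,
      (((s * ξ ω : ℝ) : ℂ) * Complex.I) ^ m / (m.factorial : ℂ)) μ := by
    refine Integrable.of_bound (by fun_prop)
      (∑ m ∈ Finset.range 3, (|s| * M) ^ m / (m.factorial : ℝ)) (ae_of_all _ fun ω => ?_)
    refine (norm_sum_le _ _).trans (Finset.sum_le_sum fun m _ => ?_)
    rw [norm_div, norm_pow, Complex.norm_natCast]
    have := hbd ω
    gcongr
  have hQ : ∫ ω, ∑ m ∈ Finset.range 3,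
      (((s * ξ ω : ℝ) : ℂ) * Complex.I) ^ m / (m.factorial : ℂ) ∂μ =
      1 - ((s ^ 2 * ∫ ω, ξ ω ^ 2 ∂μ) / 2 : ℝ) := by
    have : ∀ ω, ∑ m ∈ Finset.range 3,
        (((s * ξ ω : ℝ) : ℂ) * Complex.I) ^ m / (m.factorial : ℂ) =
        ((1 - s ^ 2 / 2 * ξ ω ^ 2 : ℝ) : ℂ) + ((ξ ω : ℝ) : ℂ) * (s * Complex.I) := fun ω => by
      simp only [Finset.sum_range_succ, Finset.sum_range_zero, Nat.factorial]
      push_cast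
      norm_num
      linear_combination ((s : ℂ) * (ξ ω : ℂ)) ^ 2 / 2 * Complex.I_sq
    simp only [this]
    rw [integral_add, integral_mul_const, integral_complex_ofReal, integral_complex_ofReal, h0,
      integral_sub (integrable_const _) (hint2.const_mul _), integral_const_mul]
    · simp
      ring
    · exact ((integrable_const _).sub (hint2.const_mul _)).ofReal
    · exact hint1.ofReal.mul_const _
  rw [charFun_apply_real, integral_map hξ (by fun_prop), ← hQ]
  have hcast : ∀ ω, Complex.exp ((s : ℂ) * ((ξ ω : ℝ) : ℂ) * Complex.I) =
      Complex.exp (((s * ξ ω : ℝ) : ℂ) * Complex.I) := fun ω => by push_cast; rfl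
  simp only [hcast]
  rw [← integral_sub hintE hintQ]
  refine (norm_integral_le_of_norm_le_const (C := (|s| * M) ^ 3 * Real.exp (|s| * M))
    (ae_of_all _ fun ω => ?_)).trans (by simp)
  refine (Complex.norm_exp_sub_sum_le_norm_mul_exp _ 3).trans ?_
  have h1 := hbd ω
  have h2 : 0 ≤ |s| * M := (norm_nonneg _).trans h1
  gcongr

/-- By `(1 + z_n / n) ^ n → exp z` for `z_n → z`, it suffices that `n` times the deviation of the
characteristic function from `1` tends to `-t² v / 2`. -/
theorem tendsto_charFun_pow_of_bounded {ξ : ℕ → Ω → ℝ} (hξ : ∀ n, AEMeasurable (ξ n) μ) {M v : ℝ}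
    (hM : ∀ᶠ n in atTop, ∀ ω, |ξ n ω| ≤ M) (h0 : ∀ᶠ n in atTop, ∫ ω, ξ n ω ∂μ = 0)
    (hv : Tendsto (fun n => ∫ ω, ξ n ω ^ 2 ∂μ) atTop (𝓝 v)) (t : ℝ) :
    Tendsto (fun n : ℕ => charFun (μ.map (ξ n)) ((√n)⁻¹ * t) ^ n) atTop
      (𝓝 (Complex.exp ((-(t ^ 2 * v / 2) : ℝ) : ℂ))) := by
  have hs : Tendsto (fun n : ℕ => (√(n : ℝ))⁻¹) atTop (𝓝 0) :=
    tendsto_inv_atTop_zero.comp (Real.tendsto_sqrt_atTop.comp tendsto_natCast_atTop_atTop)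
  have key : Tendsto (fun n : ℕ => (n : ℂ) * (charFun (μ.map (ξ n)) ((√n)⁻¹ * t) - 1)) atTop
      (𝓝 ((-(t ^ 2 * v / 2) : ℝ) : ℂ)) := by
    have hmain : Tendsto (fun n : ℕ => ((-(t ^ 2 * (∫ ω, ξ n ω ^ 2 ∂μ) / 2) : ℝ) : ℂ)) atTop
        (𝓝 ((-(t ^ 2 * v / 2) : ℝ) : ℂ)) :=
      (Complex.continuous_ofReal.tendsto _).comp (((hv.const_mul _).div_const _).neg)
    -- At argument `t / √n` the cubic remainder is of order `n ^ (-3 / 2)`, so `n` copies still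
    -- leave `1 / √n`.
    have herr : Tendsto (fun n : ℕ => (√(n : ℝ))⁻¹ * ((|t| * M) ^ 3 *
        Real.exp ((√(n : ℝ))⁻¹ * (|t| * M)))) atTop (𝓝 0) := by
      have h1 : Tendsto (fun n : ℕ => Real.exp ((√(n : ℝ))⁻¹ * (|t| * M))) atTop
          (𝓝 (Real.exp (0 * (|t| * M)))) :=
        (Real.continuous_exp.tendsto _).comp (hs.mul_const _)
      have h2 := hs.mul (h1.const_mul ((|t| * M) ^ 3))
      rwa [zero_mul] at h2
    have hdiff : Tendsto (fun n : ℕ => (n : ℂ) * (charFun (μ.map (ξ n)) ((√n)⁻¹ * t) - 1) -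
        ((-(t ^ 2 * (∫ ω, ξ n ω ^ 2 ∂μ) / 2) : ℝ) : ℂ)) atTop (𝓝 0) := by
      refine squeeze_zero_norm' ?_ herr
      filter_upwards [hM, h0, eventually_gt_atTop 0] with n hMn h0n hn
      have hn' : (0 : ℝ) < n := Nat.cast_pos.2 hn
      have hb := norm_charFun_sub_quadratic_le (hξ n) hMn h0n ((√(n : ℝ))⁻¹ * t)
      have hsq : (n : ℝ) * ((√(n : ℝ))⁻¹) ^ 2 = 1 := by
        rw [inv_pow, Real.sq_sqrt hn'.le, mul_inv_cancel₀ hn'.ne']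
      have habs : |(√(n : ℝ))⁻¹ * t| * M = (√(n : ℝ))⁻¹ * (|t| * M) := by
        rw [abs_mul, abs_of_nonneg (by positivity), mul_assoc]
      rw [habs] at hb
      have heq : (n : ℂ) * (charFun (μ.map (ξ n)) ((√n)⁻¹ * t) - 1) -
          ((-(t ^ 2 * (∫ ω, ξ n ω ^ 2 ∂μ) / 2) : ℝ) : ℂ) =
          (n : ℂ) * (charFun (μ.map (ξ n)) ((√n)⁻¹ * t) -
            (1 - ((((√n)⁻¹ * t) ^ 2 * ∫ ω, ξ n ω ^ 2 ∂μ) / 2 : ℝ))) := by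
        have hsq' : (n : ℂ) * (((√(n : ℝ))⁻¹ : ℝ) : ℂ) ^ 2 = 1 := by exact_mod_cast hsq
        push_cast at hsq' ⊢
        linear_combination -(t ^ 2 * ((∫ ω, ξ n ω ^ 2 ∂μ : ℝ) : ℂ) / 2) * hsq'
      rw [heq, norm_mul, Complex.norm_natCast]
      refine (mul_le_mul_of_nonneg_left hb hn'.le).trans (le_of_eq ?_)
      linear_combination ((√(n : ℝ))⁻¹ * (|t| * M) ^ 3 *
        Real.exp ((√(n : ℝ))⁻¹ * (|t| * M))) * hsq
    have := hdiff.add hmain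
    simpa using this
  have := Complex.tendsto_one_add_pow_exp_of_tendsto key
  simpa using this

/-- The central limit theorem for rows `ψ n (X 0), …, ψ n (X (n - 1))` that are centred, uniformly
bounded and have converging variances. -/
theorem tendstoInDistribution_inv_sqrt_mul_sum_of_bounded {X : ℕ → Ω → ℝ} (hindep : iIndepFun X μ)
    (hident : ∀ i, IdentDistrib (X i) (X 0) μ μ) {ψ : ℕ → ℝ → ℝ} (hψ : ∀ n, Measurable (ψ n))
    {M v : ℝ} (hM : ∀ᶠ n in atTop, ∀ y, |ψ n y| ≤ M)
    (h0 : ∀ᶠ n in atTop, ∫ ω, ψ n (X 0 ω) ∂μ = 0)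
    (hv : Tendsto (fun n => ∫ ω, ψ n (X 0 ω) ^ 2 ∂μ) atTop (𝓝 v)) :
    TendstoInDistribution (fun (n : ℕ) ω => (√n)⁻¹ * ∑ k ∈ Finset.range n, ψ n (X k ω)) atTop
      (id : ℝ → ℝ) (fun _ => μ) (gaussianReal 0 v.toNNReal) where
  forall_aemeasurable n := .const_mul (Finset.aemeasurable_fun_sum _ fun k _ =>
    (hψ n).comp_aemeasurable (hident k).aemeasurable_fst) _
  tendsto := by
    -- Nonnegativity ensures that `toNNReal` does not alter `v`; the case `v = 0` gives the point
    -- mass.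
    have hv0 : 0 ≤ v := ge_of_tendsto' hv fun n => integral_nonneg fun ω => sq_nonneg _
    refine ProbabilityMeasure.tendsto_iff_tendsto_charFun.2 fun t => ?_
    have hlim := tendsto_charFun_pow_of_bounded (ξ := fun n ω => ψ n (X 0 ω))
      (fun n => (hψ n).comp_aemeasurable (hident 0).aemeasurable_fst)
      (hM.mono fun n hn ω => hn _) h0 hv t
    have hgauss : charFun ((gaussianReal 0 v.toNNReal).map id) t =
        Complex.exp ((-(t ^ 2 * v / 2) : ℝ) : ℂ) := by
      rw [Measure.map_id, charFun_gaussianReal]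
      congr 1
      push_cast [Real.coe_toNNReal v hv0]
      ring
    have hrow : ∀ n : ℕ,
        charFun (μ.map (fun ω => (√n)⁻¹ * ∑ k ∈ Finset.range n, ψ n (X k ω))) t =
          charFun (μ.map (fun ω => ψ n (X 0 ω))) ((√n)⁻¹ * t) ^ n := fun n =>
      charFun_inv_sqrt_mul_sum (X := fun k ω => ψ n (X k ω))
        (hindep.comp (fun _ => ψ n) fun _ => hψ n) fun i => (hident i).comp (hψ n)
    simp only [ProbabilityMeasure.coe_mk, hgauss, hrow]
    exact hlim

end CentralLimit

/-! ### The law of the observations -/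

section Law

/-- The Riemann–Lebesgue lemma; the scaling by `-(2 π)⁻¹` reconciles the two Fourier conventions. -/
theorem tendsto_charFun_densityLaw {f : ℝ → ℝ} (hf_meas : Measurable f) (hf_nonneg : ∀ v, 0 ≤ f v) :
    Tendsto (charFun (densityLaw f)) (cocompact ℝ) (𝓝 0) := by
  have h1 := Real.tendsto_integral_exp_smul_cocompact fun v => (f v : ℂ)
  have h2 : Tendsto (fun t : ℝ => -(2 * Real.pi)⁻¹ * t) (cocompact ℝ) (cocompact ℝ) :=
    tendsto_cocompact_mul_left₀ (by simp [Real.pi_ne_zero])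
  refine (h1.comp h2).congr fun t => ?_
  rw [Function.comp, charFun_apply_real, densityLaw,
    integral_withDensity_eq_integral_toReal_smul (by fun_prop) (by simp)]
  congr 1
  funext v
  rw [ENNReal.toReal_ofReal (hf_nonneg v), Circle.smul_def, Real.fourierChar_apply, smul_eq_mul,
    Complex.real_smul, mul_comm]
  congr 2
  push_cast
  field_simp

variable {Ω : Type*} [MeasurableSpace Ω] {μ : Measure Ω} {p σ : ℝ}
  {f : ℝ → ℝ} {U V Z X : ℕ → Ω → ℝ}

theorem IsAtomicDeconvolutionSample.aemeasurable_obs (hX : IsAtomicDeconvolutionSample μ p σ f U V Z X) (i : ℕ) :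
    AEMeasurable (X i) μ := by
  rw [show X i = fun ω => U i ω * V i ω + σ * Z i ω from funext (hX.obs_eq i)]
  have h1 := (hX.law_U i).aemeasurable
  have h2 := (hX.law_V i).aemeasurable
  have h3 := (hX.law_Z i).aemeasurable
  fun_prop

variable [IsProbabilityMeasure μ]

/-- Condition on `U`: the value `0` contributes the constant `1`, the value `1` the characteristic
function of `V`. -/
theorem charFun_map_mul_of_bernoulli (hp0 : 0 ≤ p) (hp1 : p ≤ 1) {U V : Ω → ℝ} {ν : Measure ℝ}
    (hU : HasLaw U (bernoulliZeroLaw p) μ) (hV : HasLaw V ν μ) (hUV : IndepFun U V μ) (t : ℝ) :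
    charFun (μ.map fun ω => U ω * V ω) t = p + (1 - p) * charFun ν t := by
  have : IsProbabilityMeasure ν := hV.isProbabilityMeasure_iff.1 inferInstance
  have : IsProbabilityMeasure (bernoulliZeroLaw p) := hU.isProbabilityMeasure_iff.1 inferInstance
  have hprod := (indepFun_iff_map_prod_eq_prod_map_map hU.aemeasurable hV.aemeasurable).1 hUV
  rw [hU.map_eq, hV.map_eq] at hprod
  have hint : Integrable (fun q : ℝ × ℝ => Complex.exp (t * (q.1 * q.2) * Complex.I))
      ((bernoulliZeroLaw p).prod ν) :=
    Integrable.of_bound (by fun_prop) 1 (ae_of_all _ fun q => by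
      rw [show (t : ℂ) * (q.1 * q.2) = ((t * (q.1 * q.2) : ℝ) : ℂ) by push_cast; ring,
        Complex.norm_exp_ofReal_mul_I])
  rw [charFun_apply_real, integral_map (show AEMeasurable (fun ω => U ω * V ω) μ from
    hU.aemeasurable.mul hV.aemeasurable) (by fun_prop)]
  have hmap := integral_map (hU.aemeasurable.prodMk hV.aemeasurable)
    (f := fun q : ℝ × ℝ => Complex.exp (t * (q.1 * q.2) * Complex.I)) (by fun_prop)
  rw [hprod] at hmap
  push_cast
  rw [← hmap, integral_prod _ hint, bernoulliZeroLaw, integral_add_measure,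
    integral_smul_measure, integral_smul_measure, integral_dirac, integral_dirac,
    ENNReal.toReal_ofReal hp0, ENNReal.toReal_ofReal (by linarith)]
  · simp [charFun_apply_real]
  · exact (integrable_dirac (by simp)).smul_measure ENNReal.ofReal_ne_top
  · exact (integrable_dirac (by simp)).smul_measure ENNReal.ofReal_ne_top

namespace IsAtomicDeconvolutionSample

/-- The explicit Gaussian factor is what later cancels the weight `exp (l s² / 2)` in every
expectation. -/
theorem charFun_obs (hX : IsAtomicDeconvolutionSample μ p σ f U V Z X) (hp0 : 0 ≤ p) (hp1 : p ≤ 1)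
    (i : ℕ) (t : ℝ) : charFun (μ.map (X i)) t =
      (p + (1 - p) * charFun (densityLaw f) t) * (Real.exp (-(σ ^ 2 * t ^ 2) / 2) : ℝ) := by
  rw [show X i = fun ω => U i ω * V i ω + σ * Z i ω from funext (hX.obs_eq i)]
  have h1 := (hX.law_U i).aemeasurable
  have h2 := (hX.law_V i).aemeasurable
  have h3 := (hX.law_Z i).aemeasurable
  have hind : IndepFun (fun ω => U i ω * V i ω) (fun ω => σ * Z i ω) μ :=
    (hX.indep_YZ i).comp measurable_id (measurable_const_mul σ)
  rw [IndepFun.charFun_map_fun_add_eq_mul (by fun_prop) (by fun_prop) hind]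
  simp only [Pi.mul_apply]
  rw [charFun_map_mul_of_bernoulli hp0 hp1 (hX.law_U i) (hX.law_V i) (hX.indep_UV i) t,
    charFun_map_mul_comp h3, (hX.law_Z i).map_eq, charFun_gaussianReal]
  congr 1
  push_cast
  congr 1
  ring

theorem identDistrib_obs (hX : IsAtomicDeconvolutionSample μ p σ f U V Z X) (hp0 : 0 ≤ p)
    (hp1 : p ≤ 1) (i : ℕ) : IdentDistrib (X i) (X 0) μ μ where
  aemeasurable_fst := hX.aemeasurable_obs i
  aemeasurable_snd := hX.aemeasurable_obs 0
  map_eq := by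
    have := Measure.isProbabilityMeasure_map (hX.aemeasurable_obs i)
    have := Measure.isProbabilityMeasure_map (hX.aemeasurable_obs 0)
    refine Measure.ext_of_charFun (funext fun t => ?_)
    rw [hX.charFun_obs hp0 hp1, hX.charFun_obs hp0 hp1]

theorem norm_charFun_obs_le (hX : IsAtomicDeconvolutionSample μ p σ f U V Z X) (hp0 : 0 ≤ p)
    (hp1 : p ≤ 1) (i : ℕ) (t : ℝ) :
    ‖charFun (μ.map (X i)) t‖ ≤ Real.exp (-(σ ^ 2 * t ^ 2) / 2) := by
  have : IsProbabilityMeasure (densityLaw f) :=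
    (hX.law_V i).isProbabilityMeasure_iff.1 inferInstance
  rw [hX.charFun_obs hp0 hp1, norm_mul, Complex.norm_real, Real.norm_of_nonneg (Real.exp_pos _).le]
  refine mul_le_of_le_one_left (Real.exp_pos _).le ?_
  refine (norm_add_le _ _).trans ?_
  rw [norm_mul, show (1 : ℂ) - p = ((1 - p : ℝ) : ℂ) by push_cast; ring, Complex.norm_real,
    Complex.norm_real, Real.norm_of_nonneg hp0, Real.norm_of_nonneg (sub_nonneg.2 hp1)]
  have := norm_charFun_le_one (μ := densityLaw f) t
  nlinarith [sub_nonneg.2 hp1]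

end IsAtomicDeconvolutionSample

theorem integral_cos_mul_sub {Y : Ω → ℝ} (hY : AEMeasurable Y μ) (t x : ℝ) :
    ∫ ω, Real.cos (t * (Y ω - x)) ∂μ =
      (Complex.exp (-(t * x : ℝ) * Complex.I) * charFun (μ.map Y) t).re := by
  have hint : Integrable (fun ω => Complex.exp ((t * Y ω : ℝ) * Complex.I)) μ :=
    Integrable.of_bound (by fun_prop) 1 (ae_of_all _ fun ω => by
      rw [Complex.norm_exp_ofReal_mul_I])
  rw [charFun_apply_real, integral_map hY (by fun_prop)]
  have hcast : ∀ ω, Complex.exp ((t : ℂ) * ((Y ω : ℝ) : ℂ) * Complex.I) =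
      Complex.exp (((t * Y ω : ℝ) : ℂ) * Complex.I) := fun ω => by push_cast; rfl
  simp only [hcast]
  rw [← integral_const_mul, ← RCLike.re_to_complex, ← integral_re (hint.const_mul _)]
  congr 1
  funext ω
  rw [← Complex.exp_add, ← add_mul, RCLike.re_to_complex,
    show (-((t * x : ℝ) : ℂ) + ((t * Y ω : ℝ) : ℂ)) = ((t * (Y ω - x) : ℝ) : ℂ) by push_cast; ring,
    Complex.exp_ofReal_mul_I_re]

theorem abs_integral_cos_mul_sub_le {Y : Ω → ℝ} (hY : AEMeasurable Y μ) (t x : ℝ) :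
    |∫ ω, Real.cos (t * (Y ω - x)) ∂μ| ≤ ‖charFun (μ.map Y) t‖ := by
  rw [integral_cos_mul_sub hY]
  refine (Complex.abs_re_le_norm _).trans ?_
  rw [norm_mul, show -((t * x : ℝ) : ℂ) = ((-(t * x) : ℝ) : ℂ) by push_cast; ring,
    Complex.norm_exp_ofReal_mul_I, one_mul]

end Law

/-! ### Representation of the estimators by cosine transforms -/

section Representation

/-- Evenness folds the real part of a Fourier integral onto `[0, 1]`, where the Laplace asymptotics
are stated. -/
theorem re_intervalIntegral_eq_two_mul {G : ℝ → ℂ} {r : ℝ → ℝ}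
    (hG : IntervalIntegrable G volume (-1) 1) (hr : ∀ s, (G s).re = r s)
    (heven : ∀ s, r (-s) = r s) :
    (∫ s in (-1 : ℝ)..1, G s).re = 2 * ∫ s in (0 : ℝ)..1, r s := by
  have hre : (∫ s in (-1 : ℝ)..1, G s).re = ∫ s in (-1 : ℝ)..1, r s := by
    rw [intervalIntegral.integral_of_le (by norm_num), intervalIntegral.integral_of_le (by norm_num),
      ← RCLike.re_to_complex, ← integral_re
        ((intervalIntegrable_iff_integrableOn_Ioc_of_le (by norm_num)).1 hG)]
    simp only [RCLike.re_to_complex, hr]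
  have hrint : IntervalIntegrable r volume (-1) 1 := by
    rw [intervalIntegrable_iff_integrableOn_Ioc_of_le (by norm_num)] at hG ⊢
    refine (Integrable.re hG).congr (ae_of_all _ fun s => ?_)
    exact hr s
  have hleft : IntervalIntegrable r volume (-1) 0 :=
    hrint.mono_set (by rw [Set.uIcc_of_le (by norm_num), Set.uIcc_of_le (by norm_num)]
                       exact Set.Icc_subset_Icc_right zero_le_one)
  have hright : IntervalIntegrable r volume 0 1 :=
    hrint.mono_set (by rw [Set.uIcc_of_le (by norm_num), Set.uIcc_of_le (by norm_num)]
                       exact Set.Icc_subset_Icc_left (by norm_num))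
  have hneg := intervalIntegral.integral_comp_neg (a := 0) (b := 1) r
  simp only [heven, neg_zero] at hneg
  rw [hre, ← intervalIntegral.integral_add_adjacent_intervals hleft hright, ← hneg]
  ring

theorem re_cexp_mul_ofReal (a b : ℝ) :
    (Complex.exp ((a : ℂ) * Complex.I) * (b : ℂ)).re = Real.cos a * b := by
  rw [Complex.re_mul_ofReal, Complex.exp_ofReal_mul_I_re]

theorem integral_average_cos {φ : ℝ → ℝ} (hint : IntervalIntegrable φ volume 0 1) (l : ℝ) (n : ℕ)
    (θ : ℕ → ℝ) :
    ∫ s in (0 : ℝ)..1, (1 / (n : ℝ)) * ∑ j ∈ Finset.range n,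
        Real.cos (s * θ j) * φ s * Real.exp (l * s ^ 2 / 2) =
      (1 / (n : ℝ)) * ∑ j ∈ Finset.range n, cosLaplace φ l (θ j) := by
  rw [intervalIntegral.integral_const_mul, intervalIntegral.integral_finsetSum fun j _ =>
    intervalIntegrable_cosLaplace hint l (θ j)]
  rfl

variable {Ω : Type*}

theorem continuous_empCharFun (X : ℕ → Ω → ℝ) (n : ℕ) (ω : Ω) :
    Continuous (empCharFun X n ω) := by
  unfold empCharFun
  fun_prop

theorem empCharFun_eq (X : ℕ → Ω → ℝ) (n : ℕ) (ω : Ω) (t : ℝ) :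
    empCharFun X n ω t = ((1 / (n : ℝ) : ℝ) : ℂ) * ∑ j ∈ Finset.range n,
      Complex.exp ((t * X j ω : ℝ) * Complex.I) := by
  unfold empCharFun
  push_cast
  congr 2
  funext j
  congr 1
  ring

variable {σ g h x q : ℝ} {φ : ℝ → ℝ}

theorem gauss_inv (σ g s : ℝ) :
    (Real.exp (-(σ ^ 2 * (s / g) ^ 2) / 2))⁻¹ = Real.exp (σ ^ 2 / g ^ 2 * s ^ 2 / 2) := by
  rw [← Real.exp_neg]
  congr 1
  ring

/-- The substitution `s = g t` turns the inverse Gaussian factor into `exp (l s² / 2)` with `l = σ²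
/ g²`. The prefactor `g / 2` is cancelled by the Jacobian and the folding. -/
theorem pEst_eq (hg : 0 < g) (hint : IntervalIntegrable φ volume (-1) 1)
    (hsymm : ∀ t, φ (-t) = φ t) (X : ℕ → Ω → ℝ) (n : ℕ) (ω : Ω) :
    pEst σ φ X g n ω =
      (1 / (n : ℝ)) * ∑ j ∈ Finset.range n, cosLaplace φ (σ ^ 2 / g ^ 2) (X j ω / g) := by
  have hint0 : IntervalIntegrable φ volume 0 1 :=
    hint.mono_set (by rw [Set.uIcc_of_le (by norm_num), Set.uIcc_of_le (by norm_num)]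
                      exact Set.Icc_subset_Icc_left (by norm_num))
  set F : ℝ → ℂ := fun t =>
    empCharFun X n ω t * (φ (g * t) : ℂ) / (Real.exp (-(σ ^ 2 * t ^ 2) / 2) : ℂ) with hF
  have hsub := intervalIntegral.integral_comp_div (a := -1) (b := 1) F hg.ne'
  have hGF : ∀ s, F (s / g) = empCharFun X n ω (s / g) *
      (Real.exp (σ ^ 2 / g ^ 2 * s ^ 2 / 2) : ℝ) * (φ s : ℂ) := fun s => by
    rw [hF]
    simp only
    rw [div_eq_mul_inv, ← Complex.ofReal_inv, gauss_inv, mul_div_cancel₀ _ hg.ne']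
    ring
  have hre := re_intervalIntegral_eq_two_mul (G := fun s => F (s / g))
    (r := fun s => (1 / (n : ℝ)) * ∑ j ∈ Finset.range n,
      Real.cos (s * (X j ω / g)) * φ s * Real.exp (σ ^ 2 / g ^ 2 * s ^ 2 / 2)) ?_ ?_ ?_
  · rw [pEst, pEstIntegral, ← integral_average_cos hint0]
    have h2 : ((g : ℂ) / 2 * ∫ t in (-(1 / g))..(1 / g), F t) =
        ((1 / 2 : ℝ) : ℂ) * ∫ s in (-1 : ℝ)..1, F (s / g) := by
      rw [hsub, Complex.real_smul, neg_div]
      push_cast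
      ring
    rw [h2, Complex.re_ofReal_mul, hre]
    ring
  · simp only [hGF]
    refine IntervalIntegrable.continuousOn_mul ?_ (Continuous.continuousOn ?_)
    · rw [intervalIntegrable_iff] at hint ⊢
      exact hint.ofReal
    · exact ((continuous_empCharFun X n ω).comp (by fun_prop)).mul
        (Complex.continuous_ofReal.comp (by fun_prop))
  · intro s
    rw [hGF, empCharFun_eq, mul_assoc, ← Complex.ofReal_mul, mul_assoc, Complex.re_ofReal_mul,
      Finset.sum_mul, Complex.re_sum]
    congr 1
    refine Finset.sum_congr rfl fun j _ => ?_
    rw [re_cexp_mul_ofReal, show s / g * X j ω = s * (X j ω / g) by ring]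
    ring
  · intro s
    simp [hsymm]

/-- The deconvolution kernel of bandwidth `h`, for the kernel with Fourier transform `φ`. -/
noncomputable def deconvKernel (φ : ℝ → ℝ) (σ h y : ℝ) : ℝ :=
  1 / (Real.pi * h) * cosLaplace φ (σ ^ 2 / h ^ 2) (y / h)

/-- The average of the deconvolution kernel over the sample. -/
noncomputable def deconvAverage (σ : ℝ) (φ : ℝ → ℝ) (X : ℕ → Ω → ℝ) (h : ℝ) (n : ℕ) (x : ℝ)
    (ω : Ω) : ℝ :=
  1 / (n : ℝ) * ∑ j ∈ Finset.range n, deconvKernel φ σ h (X j ω - x)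

/-- The kernel with Fourier transform `φ`, rescaled to bandwidth `h`. -/
noncomputable def scaledKernel (φ : ℝ → ℝ) (h x : ℝ) : ℝ :=
  1 / (Real.pi * h) * cosLaplace φ 0 (x / h)

theorem integral_density_integrand_eq (hh : 0 < h) (hsupp : Function.support φ ⊆ Set.Icc (-1) 1)
    (H : ℝ → ℂ) :
    ∫ t : ℝ, H t * (φ (h * t) : ℂ) =
      ((1 / h : ℝ) : ℂ) * ∫ s in (-1 : ℝ)..1, H (s / h) * (φ s : ℂ) := by
  have h1 := Measure.integral_comp_div (fun t : ℝ => H t * (φ (h * t) : ℂ)) h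
  simp only [mul_div_cancel₀ _ hh.ne'] at h1
  have h2 : ∫ s : ℝ, H (s / h) * (φ s : ℂ) = ∫ s in (-1 : ℝ)..1, H (s / h) * (φ s : ℂ) := by
    rw [intervalIntegral.integral_of_le (by norm_num), ← integral_Icc_eq_integral_Ioc]
    symm
    refine setIntegral_eq_integral_of_forall_compl_eq_zero fun s hs => ?_
    have : φ s = 0 := by
      by_contra hne
      exact hs (hsupp hne)
    simp [this]
  rw [← h2, h1, abs_of_pos hh, Complex.real_smul, ← mul_assoc, ← Complex.ofReal_mul,
    one_div_mul_cancel hh.ne', Complex.ofReal_one, one_mul]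

/-- After rescaling, the Gaussian term loses its weight and becomes `W = scaledKernel φ h x`. Then
`S - q W = (S - W) + (1 - q) W` isolates the dependence on `q` in the factor `1 / (1 - q)`. -/
theorem re_densityEstIntegral (hh : 0 < h) (hint : IntervalIntegrable φ volume (-1) 1)
    (hsymm : ∀ t, φ (-t) = φ t) (hsupp : Function.support φ ⊆ Set.Icc (-1) 1) (hq : q ≠ 1)
    (X : ℕ → Ω → ℝ) (n : ℕ) (ω : Ω) :
    (densityEstIntegral σ φ X h q n x ω).re =
      (deconvAverage σ φ X h n x ω - scaledKernel φ h x) / (1 - q) + scaledKernel φ h x := by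
  have hq' : 1 - q ≠ 0 := sub_ne_zero.2 hq.symm
  have hint0 : IntervalIntegrable φ volume 0 1 :=
    hint.mono_set (by rw [Set.uIcc_of_le (by norm_num), Set.uIcc_of_le (by norm_num)]
                      exact Set.Icc_subset_Icc_left (by norm_num))
  rw [densityEstIntegral, integral_density_integrand_eq hh hsupp]
  have hH : ∀ s : ℝ, Complex.exp (-Complex.I * (s / h : ℝ) * x) *
      ((empCharFun X n ω (s / h) - (q : ℂ) * (Real.exp (-(σ ^ 2 * (s / h) ^ 2) / 2) : ℂ)) /
        ((1 - (q : ℂ)) * (Real.exp (-(σ ^ 2 * (s / h) ^ 2) / 2) : ℂ))) =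
      Complex.exp ((-(s * (x / h)) : ℝ) * Complex.I) * ((1 / (1 - q) : ℝ) : ℂ) *
        (empCharFun X n ω (s / h) * (Real.exp (σ ^ 2 / h ^ 2 * s ^ 2 / 2) : ℝ) - (q : ℂ)) :=
    fun s => by
      rw [← gauss_inv]
      have h1 : ((Real.exp (-(σ ^ 2 * (s / h) ^ 2) / 2) : ℝ) : ℂ) ≠ 0 := by
        exact_mod_cast (Real.exp_pos _).ne'
      have h2 : (1 - (q : ℂ)) ≠ 0 := by exact_mod_cast hq'
      rw [show Complex.exp (-Complex.I * (s / h : ℝ) * x) =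
        Complex.exp ((-(s * (x / h)) : ℝ) * Complex.I) by congr 1; push_cast; ring]
      push_cast
      push_cast at h1
      field_simp
  have hre := re_intervalIntegral_eq_two_mul (G := fun s : ℝ =>
      Complex.exp (-Complex.I * (s / h : ℝ) * x) *
        ((empCharFun X n ω (s / h) - (q : ℂ) * (Real.exp (-(σ ^ 2 * (s / h) ^ 2) / 2) : ℂ)) /
          ((1 - (q : ℂ)) * (Real.exp (-(σ ^ 2 * (s / h) ^ 2) / 2) : ℂ))) * (φ s : ℂ))
    (r := fun s => 1 / (1 - q) * ((1 / (n : ℝ)) * ∑ j ∈ Finset.range n,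
      Real.cos (s * ((X j ω - x) / h)) * φ s * Real.exp (σ ^ 2 / h ^ 2 * s ^ 2 / 2) -
        -- The trivial exponential keeps this term in the form of `cosLaplace φ 0`.
        q * (Real.cos (s * (x / h)) * φ s * Real.exp (0 * s ^ 2 / 2)))) ?_ ?_ ?_
  · rw [show (1 / (2 * (Real.pi : ℂ))) = ((1 / (2 * Real.pi) : ℝ) : ℂ) by push_cast; rfl,
      Complex.re_ofReal_mul, Complex.re_ofReal_mul, hre, intervalIntegral.integral_const_mul,
      intervalIntegral.integral_sub, intervalIntegral.integral_const_mul (q : ℝ),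
      integral_average_cos hint0]
    · rw [deconvAverage, scaledKernel]
      simp only [deconvKernel, ← Finset.mul_sum]
      have hc : ∫ s in (0 : ℝ)..1, Real.cos (s * (x / h)) * φ s * Real.exp (0 * s ^ 2 / 2) =
        cosLaplace φ 0 (x / h) := rfl
      rw [hc]
      generalize cosLaplace φ 0 (x / h) = c
      generalize ∑ j ∈ Finset.range n, cosLaplace φ (σ ^ 2 / h ^ 2) ((X j ω - x) / h) = S
      have := Real.pi_ne_zero
      field_simp
      ring
    · refine IntervalIntegrable.const_mul ?_ _
      convert! IntervalIntegrable.sum (Finset.range n) fun j _ =>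
        intervalIntegrable_cosLaplace hint0 (σ ^ 2 / h ^ 2) ((X j ω - x) / h) using 1
      ext s
      simp
    · exact (intervalIntegrable_cosLaplace hint0 _ _).const_mul _
  · simp only [hH]
    refine IntervalIntegrable.continuousOn_mul ?_ (Continuous.continuousOn ?_)
    · rw [intervalIntegrable_iff] at hint ⊢
      exact hint.ofReal
    · refine Continuous.mul (Continuous.mul (by fun_prop) continuous_const) (Continuous.sub ?_
        continuous_const)
      exact ((continuous_empCharFun X n ω).comp (by fun_prop)).mul
        (Complex.continuous_ofReal.comp (by fun_prop))
  · intro s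
    rw [hH, empCharFun_eq,
      show ∀ a b c d e f : ℂ, a * b * (c * d * e - f) * (φ s : ℂ) =
        b * (c * (d * (a * (e * (φ s : ℂ)))) - f * (a * (φ s : ℂ))) by intros; ring,
      Complex.re_ofReal_mul, Complex.sub_re, Complex.re_ofReal_mul, Complex.re_ofReal_mul,
      Finset.sum_mul, Complex.re_sum, re_cexp_mul_ofReal]
    congr 1
    congr 1
    · congr 1
      refine Finset.sum_congr rfl fun j _ => ?_
      rw [← mul_assoc, ← Complex.exp_add, ← add_mul, ← Complex.ofReal_mul, ← Complex.ofReal_add,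
        re_cexp_mul_ofReal, show s / h * X j ω + -(s * (x / h)) = s * ((X j ω - x) / h) by ring]
      ring
    · simp
  · intro s
    simp [hsymm]

variable {ε : ℝ} {φk : ℝ → ℝ}

theorem plugInDensityEst_eq (hh : 0 < h) (hε : 0 < ε)
    (hint : IntervalIntegrable φ volume (-1) 1)
    (hsymm : ∀ t, φ (-t) = φ t) (hsupp : Function.support φ ⊆ Set.Icc (-1) 1)
    (X : ℕ → Ω → ℝ) (n : ℕ) (ω : Ω) :
    plugInDensityEst σ φ φk X h g ε n x ω =
      (deconvAverage σ φ X h n x ω - scaledKernel φ h x) / (1 - pEstTrunc σ φk X g ε n ω) +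
        scaledKernel φ h x := by
  have : pEstTrunc σ φk X g ε n ω ≤ 1 - ε := min_le_right _ _
  exact re_densityEstIntegral hh hint hsymm hsupp (by linarith) X n ω

/-- On the sequence space with coordinate projections the integrands are jointly measurable;
composing with the sample then covers observations that are only a.e. measurable. -/
theorem measurable_pEstTrunc_proj (hφk : Measurable φk) (g ε : ℝ) (n : ℕ) :
    Measurable (pEstTrunc (Ω := ℕ → ℝ) σ φk (fun j v => v j) g ε n) := by
  have h1 : StronglyMeasurable fun v : ℕ → ℝ =>
      pEstIntegral (Ω := ℕ → ℝ) σ φk (fun j v => v j) g n v := by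
    unfold pEstIntegral
    refine StronglyMeasurable.const_mul ?_ _
    simp only [intervalIntegral]
    refine StronglyMeasurable.sub ?_ ?_ <;>
    · refine StronglyMeasurable.integral_prod_right' (f := fun q : (ℕ → ℝ) × ℝ =>
        empCharFun (Ω := ℕ → ℝ) (fun j v => v j) n q.1 q.2 * (φk (g * q.2) : ℂ) /
          (Real.exp (-(σ ^ 2 * q.2 ^ 2) / 2) : ℂ)) (Measurable.stronglyMeasurable ?_)
      unfold empCharFun
      fun_prop
  exact (Complex.measurable_re.comp h1.measurable).min measurable_const

theorem measurable_plugInDensityEst_proj (hφ : Measurable φ) (hφk : Measurable φk)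
    (h g ε : ℝ) (n : ℕ) (x : ℝ) :
    Measurable (plugInDensityEst (Ω := ℕ → ℝ) σ φ φk (fun j v => v j) h g ε n x) := by
  have hq := measurable_pEstTrunc_proj (σ := σ) hφk g ε n
  have h1 : StronglyMeasurable fun v : ℕ → ℝ => densityEstIntegral (Ω := ℕ → ℝ) σ φ
      (fun j v => v j) h (pEstTrunc (Ω := ℕ → ℝ) σ φk (fun j v => v j) g ε n v) n x v := by
    unfold densityEstIntegral
    refine StronglyMeasurable.const_mul ?_ _
    refine StronglyMeasurable.integral_prod_right' (f := fun q : (ℕ → ℝ) × ℝ =>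
      Complex.exp (-Complex.I * q.2 * x) *
      ((empCharFun (Ω := ℕ → ℝ) (fun j v => v j) n q.1 q.2 -
        (pEstTrunc (Ω := ℕ → ℝ) σ φk (fun j v => v j) g ε n q.1 : ℂ) *
          (Real.exp (-(σ ^ 2 * q.2 ^ 2) / 2) : ℂ)) /
        ((1 - (pEstTrunc (Ω := ℕ → ℝ) σ φk (fun j v => v j) g ε n q.1 : ℂ)) *
          (Real.exp (-(σ ^ 2 * q.2 ^ 2) / 2) : ℂ))) * (φ (h * q.2) : ℂ))
      (Measurable.stronglyMeasurable ?_)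
    unfold empCharFun
    fun_prop
  exact Complex.measurable_re.comp h1.measurable

variable [MeasurableSpace Ω] {μ : Measure Ω} {X : ℕ → Ω → ℝ}

theorem aemeasurable_pEstTrunc (hX : ∀ i, AEMeasurable (X i) μ) (hφk : Measurable φk)
    (g ε : ℝ) (n : ℕ) : AEMeasurable (pEstTrunc σ φk X g ε n) μ :=
  (measurable_pEstTrunc_proj (σ := σ) hφk g ε n).comp_aemeasurable
    (aemeasurable_pi_lambda (fun ω j => X j ω) hX)

theorem aemeasurable_plugInDensityEst (hX : ∀ i, AEMeasurable (X i) μ) (hφ : Measurable φ)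
    (hφk : Measurable φk) (h g ε : ℝ) (n : ℕ) (x : ℝ) :
    AEMeasurable (plugInDensityEst σ φ φk X h g ε n x) μ :=
  (measurable_plugInDensityEst_proj (σ := σ) hφ hφk h g ε n x).comp_aemeasurable
    (aemeasurable_pi_lambda (fun ω j => X j ω) hX)

end Representation

/-! ### Moment bounds -/

section Moments

variable {Ω : Type*} [MeasurableSpace Ω] {μ : Measure Ω}

theorem integral_abs_mul_le {F G : Ω → ℝ} (hF : MemLp F 2 μ) (hG : MemLp G 2 μ) :
    ∫ ω, |F ω * G ω| ∂μ ≤ √(∫ ω, F ω ^ 2 ∂μ) * √(∫ ω, G ω ^ 2 ∂μ) := by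
  have h := integral_mul_norm_le_Lp_mul_Lq Real.HolderConjugate.two_two
    (f := F) (g := G) (μ := μ) (by simpa using hF) (by simpa using hG)
  simpa [abs_mul, Real.sqrt_eq_rpow] using h

variable [IsProbabilityMeasure μ]

theorem integral_average_eq {X : ℕ → Ω → ℝ} (hident : ∀ i, IdentDistrib (X i) (X 0) μ μ)
    {ψ : ℝ → ℝ} (hψ : Measurable ψ) {M : ℝ} (hM : ∀ y, |ψ y| ≤ M) {n : ℕ} (hn : 0 < n) :
    ∫ ω, 1 / (n : ℝ) * ∑ j ∈ Finset.range n, ψ (X j ω) ∂μ = ∫ ω, ψ (X 0 ω) ∂μ := by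
  have hmeas : ∀ j, AEMeasurable (fun ω => ψ (X j ω)) μ := fun j =>
    hψ.comp_aemeasurable (hident j).aemeasurable_fst
  rw [integral_const_mul, integral_finsetSum _ fun j _ =>
    Integrable.of_bound (hmeas j).aestronglyMeasurable M (ae_of_all _ fun ω => hM _)]
  have : ∀ j ∈ Finset.range n, ∫ ω, ψ (X j ω) ∂μ = ∫ ω, ψ (X 0 ω) ∂μ := fun j _ =>
    ((hident j).comp hψ).integral_eq
  rw [Finset.sum_congr rfl this, Finset.sum_const, Finset.card_range, nsmul_eq_mul]
  have : (n : ℝ) ≠ 0 := Nat.cast_ne_zero.2 hn.ne'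
  field_simp

theorem integral_sq_average_sub_le {X : ℕ → Ω → ℝ} (hindep : iIndepFun X μ)
    (hident : ∀ i, IdentDistrib (X i) (X 0) μ μ) {ψ : ℝ → ℝ} (hψ : Measurable ψ) {M : ℝ}
    (hM : ∀ y, |ψ y| ≤ M) {n : ℕ} (hn : 0 < n) :
    ∫ ω, (1 / (n : ℝ) * ∑ j ∈ Finset.range n, ψ (X j ω) - ∫ ω', ψ (X 0 ω') ∂μ) ^ 2 ∂μ ≤
      1 / (n : ℝ) * ∫ ω, ψ (X 0 ω) ^ 2 ∂μ := by
  have hn' : (n : ℝ) ≠ 0 := Nat.cast_ne_zero.2 hn.ne'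
  have hmeas : ∀ j, AEMeasurable (fun ω => ψ (X j ω)) μ := fun j =>
    hψ.comp_aemeasurable (hident j).aemeasurable_fst
  have hvar := variance_const_mul (1 / (n : ℝ)) (fun ω => ∑ j ∈ Finset.range n, ψ (X j ω)) μ
  rw [variance_eq_integral ((Finset.aemeasurable_fun_sum _ fun j _ => hmeas j).const_mul _),
    integral_average_eq hident hψ hM hn] at hvar
  rw [hvar]
  have hsum : Var[fun ω => ∑ j ∈ Finset.range n, ψ (X j ω); μ] =
      n * Var[fun ω => ψ (X 0 ω); μ] := by
    have h1 := IndepFun.variance_sum (μ := μ) (X := fun j ω => ψ (X j ω)) (s := Finset.range n)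
      (fun j _ => MemLp.of_bound (hmeas j).aestronglyMeasurable M (ae_of_all _ fun ω => hM _))
      (fun i _ j _ hij => (hindep.indepFun hij).comp hψ hψ)
    have h2 : (∑ j ∈ Finset.range n, fun ω => ψ (X j ω)) =
        fun ω => ∑ j ∈ Finset.range n, ψ (X j ω) := by
      ext ω
      simp
    have h3 : ∀ j ∈ Finset.range n, Var[fun ω => ψ (X j ω); μ] = Var[fun ω => ψ (X 0 ω); μ] :=
      fun j _ => ((hident j).comp hψ).variance_eq
    rw [h2, Finset.sum_congr rfl h3] at h1
    rw [h1, Finset.sum_const, Finset.card_range, nsmul_eq_mul]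
  have hle := variance_le_expectation_sq (hmeas 0).aestronglyMeasurable
  simp only [Pi.pow_apply] at hle
  rw [hsum, show (1 / (n : ℝ)) ^ 2 * (n * Var[fun ω => ψ (X 0 ω); μ]) =
    1 / (n : ℝ) * Var[fun ω => ψ (X 0 ω); μ] by field_simp]
  gcongr

theorem integral_abs_le_sqrt {F : Ω → ℝ} (hF : MemLp F 2 μ) :
    ∫ ω, |F ω| ∂μ ≤ √(∫ ω, F ω ^ 2 ∂μ) := by
  simpa using integral_abs_mul_le hF (memLp_const (1 : ℝ))

/-- Markov's inequality; it allows all remainders to be controlled in L¹. -/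
theorem tendstoInMeasure_zero_of_integral_abs_le {Y : ℕ → Ω → ℝ} {b : ℕ → ℝ}
    (hY : ∀ᶠ n in atTop, Integrable (Y n) μ ∧ ∫ ω, |Y n ω| ∂μ ≤ b n)
    (hb : Tendsto b atTop (𝓝 0)) : TendstoInMeasure μ Y atTop 0 := by
  refine tendstoInMeasure_iff_measureReal_norm.2 fun e he => ?_
  have h1 := hb.const_mul e⁻¹
  rw [mul_zero] at h1
  refine squeeze_zero' (Eventually.of_forall fun n => measureReal_nonneg) ?_ h1
  filter_upwards [hY] with n hn
  have h2 := mul_meas_ge_le_integral_of_nonneg (ae_of_all μ fun ω => abs_nonneg (Y n ω))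
    hn.1.abs e
  simp only [Pi.zero_apply, sub_zero, Real.norm_eq_abs]
  rw [inv_mul_eq_div, le_div_iff₀' he]
  exact h2.trans hn.2

/-- The `L¹` bound for a centred variable. -/
theorem integral_abs_sub_integral_le {F : Ω → ℝ} (hF : Integrable F μ) :
    ∫ ω, |F ω - ∫ ω', F ω' ∂μ| ∂μ ≤ 2 * ∫ ω, |F ω| ∂μ := by
  have h1 : ∫ ω, |F ω - ∫ ω', F ω' ∂μ| ∂μ ≤ ∫ ω, (|F ω| + |∫ ω', F ω' ∂μ|) ∂μ :=
    integral_mono (hF.sub (integrable_const _)).abs (hF.abs.add (integrable_const _))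
      fun ω => abs_sub _ _
  rw [integral_add hF.abs (integrable_const _)] at h1
  have h2 := abs_integral_le_integral_abs (μ := μ) (f := F)
  simp at h1
  linarith

/-! ### Expectations of cosine transforms -/

theorem integral_cosLaplace {φ : ℝ → ℝ} (hφ : Measurable φ)
    (hint : IntervalIntegrable φ volume 0 1) {Y : Ω → ℝ} (hY : AEMeasurable Y μ) (l h x : ℝ) :
    ∫ ω, cosLaplace φ l ((Y ω - x) / h) ∂μ =
      ∫ s in (0 : ℝ)..1, (∫ ω, Real.cos (s / h * (Y ω - x)) ∂μ) * φ s *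
        Real.exp (l * s ^ 2 / 2) := by
  have : IsProbabilityMeasure (μ.map Y) := Measure.isProbabilityMeasure_map hY
  have h1 : ∀ s, ∫ ω, Real.cos (s / h * (Y ω - x)) ∂μ =
      ∫ y, Real.cos (s / h * (y - x)) ∂(μ.map Y) := fun s =>
    (integral_map hY (f := fun y => Real.cos (s / h * (y - x))) (by fun_prop)).symm
  have h2 : ∫ ω, cosLaplace φ l ((Y ω - x) / h) ∂μ =
      ∫ y, cosLaplace φ l ((y - x) / h) ∂(μ.map Y) :=
    (integral_map hY (f := fun y => cosLaplace φ l ((y - x) / h))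
      ((measurable_cosLaplace hφ l).comp (by fun_prop)).aestronglyMeasurable).symm
  rw [h2]
  simp only [h1, cosLaplace, intervalIntegral.integral_of_le (zero_le_one' ℝ)]
  rw [integral_integral_swap]
  · congr 1
    funext s
    rw [integral_mul_const, integral_mul_const]
    congr 3
    funext y
    congr 1
    ring
  · have hdom : Integrable (fun q : ℝ × ℝ => |φ q.2| * Real.exp (l * q.2 ^ 2 / 2))
        ((μ.map Y).prod (volume.restrict (Set.Ioc 0 1))) := by
      have h3 : IntervalIntegrable (fun s => |φ s| * Real.exp (l * s ^ 2 / 2)) volume 0 1 :=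
        hint.abs.mul_continuousOn (by fun_prop)
      rw [intervalIntegrable_iff_integrableOn_Ioc_of_le zero_le_one] at h3
      exact Integrable.comp_snd h3 _
    refine hdom.mono (Measurable.aestronglyMeasurable (by fun_prop)) (ae_of_all _ fun q => ?_)
    simp only [Function.uncurry, norm_mul, Real.norm_eq_abs, abs_abs, Real.abs_exp]
    gcongr
    exact mul_le_of_le_one_left (abs_nonneg _) (Real.abs_cos_le_one _)

/-- After Fubini, the Gaussian decay of the characteristic function cancels `exp (l s² / 2)`. The
mean of the kernel transform is thus bounded independently of `h`, although its supremum may grow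
exponentially. -/
theorem abs_integral_cosLaplace_le {φ : ℝ → ℝ} (hφ : Measurable φ)
    (hint : IntervalIntegrable φ volume 0 1) {Y : Ω → ℝ} (hY : AEMeasurable Y μ) {σ : ℝ}
    (hchar : ∀ t, ‖charFun (μ.map Y) t‖ ≤ Real.exp (-(σ ^ 2 * t ^ 2) / 2)) (h x : ℝ) :
    |∫ ω, cosLaplace φ (σ ^ 2 / h ^ 2) ((Y ω - x) / h) ∂μ| ≤
      cosLaplace (fun s => |φ s|) 0 0 := by
  rw [integral_cosLaplace hφ hint hY, cosLaplace_zero, ← Real.norm_eq_abs]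
  refine intervalIntegral.norm_integral_le_of_norm_le zero_le_one (ae_of_all _ fun s _ => ?_)
    (hint.abs.mul_continuousOn (by fun_prop))
  have h1 := (abs_integral_cos_mul_sub_le hY (s / h) x).trans (hchar (s / h))
  rw [norm_mul, norm_mul, Real.norm_eq_abs, Real.norm_eq_abs, Real.norm_eq_abs, Real.abs_exp,
    ← gauss_inv]
  refine (mul_le_mul_of_nonneg_right (mul_le_mul_of_nonneg_right h1 (abs_nonneg _))
    (inv_nonneg.2 (Real.exp_pos _).le)).trans (le_of_eq ?_)
  rw [zero_mul, zero_div, Real.exp_zero, mul_one, mul_comm _ |φ s|, mul_assoc,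
    mul_inv_cancel₀ (Real.exp_pos _).ne', mul_one]

/-- The Gaussian factors cancel exactly, leaving the integral of `(p + (1 - p) Re χ(s / g)) φ s`. As
`g → 0`, `χ(s / g) → 0` for `s > 0`, and dominated convergence isolates the atom. -/
theorem tendsto_integral_cosLaplace {φ : ℝ → ℝ} (hφ : Measurable φ)
    (hint : IntervalIntegrable φ volume 0 1) (hone : ∫ s in (0 : ℝ)..1, φ s = 1)
    {Y : Ω → ℝ} (hY : AEMeasurable Y μ) {σ p : ℝ} {χ : ℝ → ℂ}
    (hχ1 : ∀ t, ‖χ t‖ ≤ 1) (hχm : Measurable χ) (hχ : Tendsto χ (cocompact ℝ) (𝓝 0))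
    (hchar : ∀ t, charFun (μ.map Y) t =
      (p + (1 - p) * χ t) * (Real.exp (-(σ ^ 2 * t ^ 2) / 2) : ℝ))
    {g : ℕ → ℝ} (hg : Tendsto g atTop (𝓝[>] 0)) :
    Tendsto (fun n => ∫ ω, cosLaplace φ (σ ^ 2 / g n ^ 2) (Y ω / g n) ∂μ) atTop (𝓝 p) := by
  have hEq : ∀ n, ∫ ω, cosLaplace φ (σ ^ 2 / g n ^ 2) (Y ω / g n) ∂μ =
      ∫ s in Set.Ioc (0 : ℝ) 1, (p + (1 - p) * (χ (s / g n)).re) * φ s := fun n => by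
    have h1 := integral_cosLaplace hφ hint hY (σ ^ 2 / g n ^ 2) (g n) 0
    simp only [sub_zero] at h1
    rw [h1, intervalIntegral.integral_of_le zero_le_one]
    congr 1
    funext s
    have h2 := integral_cos_mul_sub hY (s / g n) 0
    simp only [sub_zero, mul_zero, Complex.ofReal_zero, neg_zero, zero_mul, Complex.exp_zero,
      one_mul] at h2
    have h3 : (p + (1 - p) * χ (s / g n) : ℂ).re = p + (1 - p) * (χ (s / g n)).re := by
      rw [show (1 : ℂ) - p = ((1 - p : ℝ) : ℂ) by push_cast; ring, Complex.add_re,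
        Complex.ofReal_re, Complex.re_ofReal_mul]
    rw [h2, hchar, Complex.re_mul_ofReal, h3, ← gauss_inv]
    have := (Real.exp_pos (-(σ ^ 2 * (s / g n) ^ 2) / 2)).ne'
    field_simp
  simp only [hEq]
  have hlim : ∫ s in Set.Ioc (0 : ℝ) 1, (p + (1 - p) * 0) * φ s = p := by
    rw [integral_const_mul, ← intervalIntegral.integral_of_le zero_le_one, hone]
    ring
  have hint' := (intervalIntegrable_iff_integrableOn_Ioc_of_le zero_le_one).1 hint
  suffices h : Tendsto (fun n => ∫ s in Set.Ioc (0 : ℝ) 1, (p + (1 - p) * (χ (s / g n)).re) * φ s)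
      atTop (𝓝 (∫ s in Set.Ioc (0 : ℝ) 1, (p + (1 - p) * 0) * φ s)) by rwa [hlim] at h
  refine tendsto_integral_of_dominated_convergence (fun s => (|p| + |1 - p|) * |φ s|) ?_ ?_ ?_ ?_
  · intro n
    exact Measurable.aestronglyMeasurable
      (((Complex.measurable_re.comp (hχm.comp (by fun_prop))).const_mul _ |>.const_add _).mul hφ)
  · exact hint'.abs.const_mul _
  · intro n
    refine ae_of_all _ fun s => ?_
    rw [norm_mul, Real.norm_eq_abs, Real.norm_eq_abs]
    refine mul_le_mul_of_nonneg_right ((abs_add_le _ _).trans ?_) (abs_nonneg _)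
    rw [abs_mul]
    have := (Complex.abs_re_le_norm _).trans (hχ1 (s / g n))
    gcongr
    exact mul_le_of_le_one_right (abs_nonneg _) this
  · refine (ae_restrict_iff' measurableSet_Ioc).2 (ae_of_all _ fun s hs => ?_)
    have h1 : Tendsto (fun n => s / g n) atTop atTop := by
      simp only [div_eq_mul_inv]
      exact (tendsto_inv_nhdsGT_zero.comp hg).const_mul_atTop hs.1
    have h2 := (Complex.continuous_re.tendsto _).comp (hχ.comp (h1.mono_right atTop_le_cocompact))
    exact ((h2.const_mul _).const_add _).mul_const _

theorem tendsto_integral_cos_mul_sub {Y : Ω → ℝ} (hY : AEMeasurable Y μ) {σ : ℝ} (hσ : 0 < σ)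
    (hchar : ∀ t, ‖charFun (μ.map Y) t‖ ≤ Real.exp (-(σ ^ 2 * t ^ 2) / 2)) (x : ℝ)
    {u : ℕ → ℝ} (hu : Tendsto u atTop atTop) :
    Tendsto (fun n => ∫ ω, Real.cos (u n * (Y ω - x)) ∂μ) atTop (𝓝 0) := by
  have h1 : Tendsto (fun n => Real.exp (-(σ ^ 2 * u n ^ 2) / 2)) atTop (𝓝 0) := by
    refine Real.tendsto_exp_atBot.comp ?_
    have h2 : Tendsto (fun n => u n ^ 2) atTop atTop := (tendsto_pow_atTop two_ne_zero).comp hu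
    have h3 := (h2.const_mul_atTop (show 0 < σ ^ 2 / 2 by positivity))
    refine (tendsto_neg_atTop_atBot.comp h3).congr fun n => ?_
    simp only [Function.comp]
    ring
  refine squeeze_zero_norm (fun n => ?_) h1
  exact (abs_integral_cos_mul_sub_le hY _ _).trans (hchar _)

/-- By the double-angle formula the variance is `1 / 2` plus terms in the means at frequencies `u`
and `2 u`, which vanish. -/
theorem tendsto_integral_sq_cos_sub {Y : Ω → ℝ} (hY : AEMeasurable Y μ) {σ : ℝ} (hσ : 0 < σ)
    (hchar : ∀ t, ‖charFun (μ.map Y) t‖ ≤ Real.exp (-(σ ^ 2 * t ^ 2) / 2)) (x : ℝ)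
    {u : ℕ → ℝ} (hu : Tendsto u atTop atTop) :
    Tendsto (fun n => ∫ ω, (Real.cos (u n * (Y ω - x)) -
      ∫ ω', Real.cos (u n * (Y ω' - x)) ∂μ) ^ 2 ∂μ) atTop (𝓝 (1 / 2)) := by
  have h1 := tendsto_integral_cos_mul_sub hY hσ hchar x hu
  have h2 := tendsto_integral_cos_mul_sub hY hσ hchar x (hu.const_mul_atTop two_pos)
  have h3 := ((h2.div_const 2).const_add (1 / 2)).sub (h1.pow 2)
  norm_num only [zero_div, add_zero, sub_zero] at h3
  refine h3.congr fun n => ?_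
  have hcos : ∀ c : ℝ, Integrable (fun ω => Real.cos (c * (Y ω - x))) μ := fun c =>
    Integrable.of_bound (by fun_prop) 1 (ae_of_all _ fun ω => Real.abs_cos_le_one _)
  set m := ∫ ω', Real.cos (u n * (Y ω' - x)) ∂μ with hm
  have h4 : ∀ ω, (Real.cos (u n * (Y ω - x)) - m) ^ 2 =
      1 / 2 + Real.cos (2 * u n * (Y ω - x)) / 2 - 2 * m * Real.cos (u n * (Y ω - x)) + m ^ 2 :=
    fun ω => by
      rw [mul_assoc 2 (u n), Real.cos_two_mul]
      ring
  simp only [h4]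
  rw [integral_add, integral_sub, integral_add, integral_const_mul,
    integral_div 2 fun ω => Real.cos (2 * u n * (Y ω - x)), ← hm]
  · simp
    ring
  · exact integrable_const _
  · exact (hcos _).div_const _
  · exact (integrable_const _).add ((hcos _).div_const _)
  · exact (hcos _).const_mul _
  · exact ((integrable_const _).add ((hcos _).div_const _)).sub ((hcos _).const_mul _)
  · exact integrable_const _

end Moments

/-! ### Bandwidth asymptotics -/

section Bandwidth

variable {σ α : ℝ} {η δ ε : ℕ → ℝ}

theorem sq_div_bandwidth_sq (hσ : 0 < σ) {n : ℕ} (hL : 0 < (1 + η n) * Real.log n) :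
    σ ^ 2 / bandwidth σ η n ^ 2 = (1 + η n) * Real.log n := by
  rw [bandwidth, mul_pow, ← Real.rpow_natCast (_ ^ (-(1 / 2) : ℝ)), ← Real.rpow_mul hL.le]
  norm_num
  rw [Real.rpow_neg_one, ← div_div, div_self (by positivity), one_div, inv_inv]

theorem tendsto_log_natCast : Tendsto (fun n : ℕ => Real.log n) atTop atTop :=
  Real.tendsto_log_atTop.comp tendsto_natCast_atTop_atTop

theorem tendsto_one_add_mul_log (hη : Tendsto η atTop (𝓝 0)) :
    Tendsto (fun n : ℕ => (1 + η n) * Real.log n) atTop atTop := by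
  have h1 := hη.const_add 1
  rw [add_zero] at h1
  exact h1.pos_mul_atTop one_pos tendsto_log_natCast

theorem eventually_sq_div_bandwidth_sq (hσ : 0 < σ) (hη : Tendsto η atTop (𝓝 0)) :
    ∀ᶠ n in atTop, σ ^ 2 / bandwidth σ η n ^ 2 = (1 + η n) * Real.log n := by
  filter_upwards [(tendsto_one_add_mul_log hη).eventually_gt_atTop 0] with n hn
  exact sq_div_bandwidth_sq hσ hn

theorem tendsto_sq_div_bandwidth_sq (hσ : 0 < σ) (hη : Tendsto η atTop (𝓝 0)) :
    Tendsto (fun n => σ ^ 2 / bandwidth σ η n ^ 2) atTop atTop :=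
  (tendsto_one_add_mul_log hη).congr' <| (eventually_sq_div_bandwidth_sq hσ hη).mono
    fun _ hn => hn.symm

theorem tendsto_bandwidth (hσ : 0 < σ) (hη : Tendsto η atTop (𝓝 0)) :
    Tendsto (bandwidth σ η) atTop (𝓝[>] 0) := by
  refine tendsto_nhdsWithin_iff.2 ⟨?_, ?_⟩
  · have h1 := ((tendsto_rpow_neg_atTop (show (0 : ℝ) < 1 / 2 by norm_num)).comp
      (tendsto_one_add_mul_log hη)).const_mul σ
    rw [mul_zero] at h1
    exact h1
  · filter_upwards [(tendsto_one_add_mul_log hη).eventually_gt_atTop 0] with n hn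
    exact mul_pos hσ (Real.rpow_pos_of_pos hn _)

/-- Translates the normalization in `h` into the Laplace scale in `l = σ² / h²`; the leftover `(1 /
σ²) ^ (1 + α) / π` appears squared in the limiting variance. -/
theorem normalization_mul_eq (hσ : 0 < σ) {h : ℝ} (hh : 0 < h) (α : ℝ) (n : ℕ) :
    √n / (h ^ (1 + 2 * α) * Real.exp (σ ^ 2 / (2 * h ^ 2))) * (1 / (Real.pi * h)) =
      √n * ((1 / σ ^ 2) ^ (1 + α) / Real.pi *
        ((σ ^ 2 / h ^ 2) ^ (1 + α) * Real.exp (-(σ ^ 2 / h ^ 2) / 2))) := by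
  have h1 : (1 / σ ^ 2) ^ (1 + α) * (σ ^ 2 / h ^ 2) ^ (1 + α) = (h ^ (1 + 2 * α) * h)⁻¹ := by
    rw [← Real.mul_rpow (by positivity) (by positivity),
      show 1 / σ ^ 2 * (σ ^ 2 / h ^ 2) = (h ^ 2)⁻¹ by field_simp,
      Real.inv_rpow (by positivity), ← Real.rpow_natCast, ← Real.rpow_mul hh.le]
    congr 1
    nth_rewrite 3 [← Real.rpow_one h]
    rw [← Real.rpow_add hh]
    congr 1
    push_cast
    ring
  have h2 : Real.exp (-(σ ^ 2 / h ^ 2) / 2) = (Real.exp (σ ^ 2 / (2 * h ^ 2)))⁻¹ := by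
    rw [← Real.exp_neg]
    congr 1
    field_simp
  rw [h2, show ∀ a b c d e : ℝ, a * (b / c * (d * e)) = a * ((b * d) / c * e) by intros; ring, h1]
  have := Real.pi_pos
  have := Real.rpow_pos_of_pos hh (1 + 2 * α)
  field_simp

/-- Apart from a convergent power, the ratio is the exponential of `-(η - δ) log n / 2 - log ε`, and
`log ε` is negligible against `(η - δ) log n`. -/
theorem tendsto_scale_ratio (hη : Tendsto η atTop (𝓝 0)) (hδ : Tendsto δ atTop (𝓝 0))
    (hdiff : Tendsto (fun n : ℕ => (η n - δ n) * Real.log n) atTop atTop)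
    (hε : ∀ᶠ n in atTop, 0 < ε n)
    (hratio : Tendsto (fun n : ℕ => Real.log (ε n) / ((η n - δ n) * Real.log n)) atTop (𝓝 0))
    (α : ℝ) :
    Tendsto (fun n : ℕ =>
      ((1 + η n) * Real.log n) ^ (1 + α) * Real.exp (-((1 + η n) * Real.log n) / 2) /
        (((1 + δ n) * Real.log n) ^ (1 + α) * Real.exp (-((1 + δ n) * Real.log n) / 2)) / ε n)
      atTop (𝓝 0) := by
  have h1 : Tendsto (fun n => ((1 + η n) / (1 + δ n)) ^ (1 + α)) atTop
      (𝓝 (((1 + 0) / (1 + 0) : ℝ) ^ (1 + α))) :=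
    ((hη.const_add 1).div (hδ.const_add 1) (by norm_num)).rpow_const (Or.inl (by norm_num))
  have h2 : Tendsto (fun n : ℕ => (η n - δ n) * Real.log n *
      (-(1 / 2) - Real.log (ε n) / ((η n - δ n) * Real.log n))) atTop atBot := by
    have h3 := hratio.const_sub (-(1 / 2))
    exact hdiff.atTop_mul_neg (by norm_num) h3
  have h4 := h1.mul (Real.tendsto_exp_atBot.comp h2)
  rw [mul_zero] at h4
  refine h4.congr' ?_
  filter_upwards [hε, hdiff.eventually_gt_atTop 0, tendsto_log_natCast.eventually_gt_atTop 0,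
    (hη.const_add 1).eventually_const_lt (show (0 : ℝ) < 1 + 0 by norm_num),
    (hδ.const_add 1).eventually_const_lt (show (0 : ℝ) < 1 + 0 by norm_num)]
    with n hn hd hl h5 h6
  rw [Function.comp, mul_sub, mul_div_cancel₀ _ hd.ne', Real.mul_rpow h5.le hl.le,
    Real.mul_rpow h6.le hl.le, Real.div_rpow h5.le h6.le, Real.exp_sub, Real.exp_log hn,
    show (η n - δ n) * Real.log n * -(1 / 2) =
      -((1 + η n) * Real.log n) / 2 - -((1 + δ n) * Real.log n) / 2 by ring, Real.exp_sub]
  have := Real.rpow_pos_of_pos hl (1 + α)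
  have := Real.rpow_pos_of_pos h6 (1 + α)
  field_simp

theorem eventually_one_le_sqrt_mul_scale (hα : 0 ≤ α) (hη : Tendsto η atTop (𝓝 0))
    (hlog : Tendsto (fun n : ℕ => -η n * Real.log n + (1 + 2 * α) * Real.log (Real.log n))
      atTop atTop) :
    ∀ᶠ n : ℕ in atTop, 1 ≤ √n * (((1 + η n) * Real.log n) ^ (1 + α) *
      Real.exp (-((1 + η n) * Real.log n) / 2)) := by
  -- The logarithm of the product is `-η log n / 2 + (1 + α) (log (1 + η) + log log n)`. The
  -- threshold compensates for `log (1 + η) ≥ -log 2`.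
  filter_upwards [hlog.eventually_ge_atTop (2 * ((1 + α) * Real.log 2)),
    tendsto_log_natCast.eventually_ge_atTop 1,
    (hη.const_add 1).eventually_const_lt (show (1 / 2 : ℝ) < 1 + 0 by norm_num),
    eventually_gt_atTop 0] with n h1 h2 h3 hn
  have hn' : (0 : ℝ) < n := Nat.cast_pos.2 hn
  have hl : 0 < Real.log n := by linarith
  have hL : 0 < (1 + η n) * Real.log n := by nlinarith
  have hsqrt : √(n : ℝ) = Real.exp (Real.log n / 2) := by
    rw [Real.sqrt_eq_rpow, Real.rpow_def_of_pos hn']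
    congr 1
    ring
  rw [hsqrt, Real.rpow_def_of_pos hL, ← Real.exp_add, ← Real.exp_add, Real.one_le_exp_iff,
    Real.log_mul (by linarith) hl.ne']
  have h4 : -Real.log 2 ≤ Real.log (1 + η n) := by
    rw [← Real.log_inv]
    exact Real.log_le_log (by norm_num) (by linarith)
  have h5 : 0 ≤ Real.log (Real.log n) := Real.log_nonneg h2
  nlinarith

end Bandwidth

/-! ### The plug-in error and the remainder in `L¹` -/

section Errors

variable {Ω : Type*}
  {X : ℕ → Ω → ℝ} {φ φk : ℝ → ℝ} {σ h g ε x : ℝ} {n : ℕ}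

theorem abs_average_le {ψ : ℝ → ℝ} {M : ℝ} (hM0 : 0 ≤ M) (hM : ∀ y, |ψ y| ≤ M) (y : ℕ → ℝ) :
    |1 / (n : ℝ) * ∑ j ∈ Finset.range n, ψ (y j)| ≤ M := by
  rcases Nat.eq_zero_or_pos n with rfl | hn
  · simpa using hM0
  rw [abs_mul, abs_of_nonneg (by positivity), one_div, inv_mul_le_iff₀ (Nat.cast_pos.2 hn)]
  refine (Finset.abs_sum_le_sum_abs _ _).trans ((Finset.sum_le_sum fun j _ => hM _).trans ?_)
  simp

theorem measurable_deconvKernel (hφ : Measurable φ) (σ h : ℝ) : Measurable (deconvKernel φ σ h) := by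
  unfold deconvKernel
  exact ((measurable_cosLaplace hφ _).comp (by fun_prop)).const_mul _

theorem abs_deconvKernel_le (hint : IntervalIntegrable φ volume 0 1) (hh : 0 < h) (y : ℝ) :
    |deconvKernel φ σ h y| ≤
      1 / (Real.pi * h) * cosLaplace (fun s => |φ s|) (σ ^ 2 / h ^ 2) 0 := by
  have := Real.pi_pos
  rw [deconvKernel, abs_mul, abs_of_nonneg (by positivity)]
  exact mul_le_mul_of_nonneg_left (abs_cosLaplace_le hint _ _) (by positivity)

theorem abs_deconvAverage_le (hint : IntervalIntegrable φ volume 0 1) (hh : 0 < h) (ω : Ω) :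
    |deconvAverage σ φ X h n x ω| ≤
      1 / (Real.pi * h) * cosLaplace (fun s => |φ s|) (σ ^ 2 / h ^ 2) 0 := by
  have := Real.pi_pos
  exact abs_average_le (mul_nonneg (by positivity) (cosLaplace_abs_nonneg _ _))
    (fun y => abs_deconvKernel_le hint hh y) fun j => X j ω - x

theorem abs_scaledKernel_le (hint : IntervalIntegrable φ volume 0 1) (hh : 0 < h) :
    |scaledKernel φ h x| ≤ 1 / (Real.pi * h) * cosLaplace (fun s => |φ s|) 0 0 := by
  have := Real.pi_pos
  rw [scaledKernel, abs_mul, abs_of_nonneg (by positivity)]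
  exact mul_le_mul_of_nonneg_left (abs_cosLaplace_le hint _ _) (by positivity)

/-- Truncation at `1 - ε` is 1-Lipschitz and fixes `m`, and it keeps the random denominator at least
`ε`. -/
theorem abs_one_div_sub_one_div_le {P m : ℝ} (hε : 0 < ε) (hm : m ≤ 1 - ε) :
    |1 / (1 - min P (1 - ε)) - 1 / (1 - m)| ≤ 1 / (ε * (1 - m)) * |P - m| := by
  have h1 : ε ≤ 1 - min P (1 - ε) := by linarith [min_le_right P (1 - ε)]
  have h2 : 0 < 1 - m := by linarith
  have h3 : |min P (1 - ε) - m| ≤ |P - m| := by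
    have := abs_min_sub_min_le_max P (1 - ε) m (1 - ε)
    rwa [min_eq_left hm, sub_self, abs_zero, max_eq_left (abs_nonneg _)] at this
  have h4 : 0 < 1 - min P (1 - ε) := hε.trans_le h1
  rw [show 1 / (1 - min P (1 - ε)) - 1 / (1 - m) =
    1 / ((1 - min P (1 - ε)) * (1 - m)) * (min P (1 - ε) - m) by field_simp; ring, abs_mul,
    abs_of_nonneg (by positivity)]
  gcongr

variable [MeasurableSpace Ω] {μ : Measure Ω}

theorem aemeasurable_deconvAverage (hX : ∀ i, AEMeasurable (X i) μ) (hφ : Measurable φ) :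
    AEMeasurable (deconvAverage σ φ X h n x) μ := by
  unfold deconvAverage
  exact (Finset.aemeasurable_fun_sum _ fun j _ =>
    (measurable_deconvKernel hφ σ h).comp_aemeasurable ((hX j).sub_const x)).const_mul _

theorem sqrt_integral_sq_le_of_abs_le {F G : Ω → ℝ} {c : ℝ} (hc : 0 ≤ c)
    (hG : Integrable (fun ω => G ω ^ 2) μ) (hFG : ∀ ω, |F ω| ≤ c * |G ω|) :
    √(∫ ω, F ω ^ 2 ∂μ) ≤ c * √(∫ ω, G ω ^ 2 ∂μ) := by
  have h1 : ∫ ω, F ω ^ 2 ∂μ ≤ c ^ 2 * ∫ ω, G ω ^ 2 ∂μ := by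
    rw [← integral_const_mul]
    refine integral_mono_of_nonneg (ae_of_all _ fun ω => sq_nonneg _) (hG.const_mul _)
      (ae_of_all _ fun ω => ?_)
    simp only
    rw [← mul_pow, ← sq_abs (F ω), ← sq_abs (c * G ω), abs_mul, abs_of_nonneg hc]
    exact pow_le_pow_left₀ (abs_nonneg _) (hFG ω) 2
  refine (Real.sqrt_le_sqrt h1).trans (le_of_eq ?_)
  rw [Real.sqrt_mul (sq_nonneg c), Real.sqrt_sq hc]

variable [IsProbabilityMeasure μ]

theorem memLp_deconvAverage_sub (hX : ∀ i, AEMeasurable (X i) μ) (hφ : Measurable φ)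
    (hint : IntervalIntegrable φ volume 0 1) (hh : 0 < h) (c : ℝ) :
    MemLp (fun ω => deconvAverage σ φ X h n x ω - c) 2 μ :=
  MemLp.of_bound ((aemeasurable_deconvAverage hX hφ).sub_const c).aestronglyMeasurable
    (1 / (Real.pi * h) * cosLaplace (fun s => |φ s|) (σ ^ 2 / h ^ 2) 0 + |c|)
    (ae_of_all _ fun ω => (norm_sub_le _ _).trans
      (add_le_add_left (abs_deconvAverage_le hint hh ω) _))

theorem integral_sq_average_sub_le_sq (hindep : iIndepFun X μ)
    (hident : ∀ i, IdentDistrib (X i) (X 0) μ μ) {ψ : ℝ → ℝ} (hψ : Measurable ψ) {M : ℝ}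
    (hM : ∀ y, |ψ y| ≤ M) (hn : 0 < n) :
    ∫ ω, (1 / (n : ℝ) * ∑ j ∈ Finset.range n, ψ (X j ω) - ∫ ω', ψ (X 0 ω') ∂μ) ^ 2 ∂μ ≤
      (M / √n) ^ 2 := by
  refine (integral_sq_average_sub_le hindep hident hψ hM hn).trans ?_
  have h1 : ∫ ω, ψ (X 0 ω) ^ 2 ∂μ ≤ M ^ 2 := by
    have h2 := integral_mono_of_nonneg (μ := μ) (f := fun ω => ψ (X 0 ω) ^ 2)
      (g := fun _ => M ^ 2) (ae_of_all _ fun ω => sq_nonneg _) (integrable_const _)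
      (ae_of_all _ fun ω => by
        simp only
        rw [← sq_abs]
        exact pow_le_pow_left₀ (abs_nonneg _) (hM _) 2)
    simpa using h2
  rw [div_pow, Real.sq_sqrt (Nat.cast_nonneg n), div_eq_mul_one_div (M ^ 2), mul_comm (M ^ 2)]
  gcongr

theorem integral_deconvAverage (hident : ∀ i, IdentDistrib (X i) (X 0) μ μ) (hφ : Measurable φ)
    (hint : IntervalIntegrable φ volume 0 1) (hh : 0 < h) (hn : 0 < n) :
    ∫ ω, deconvAverage σ φ X h n x ω ∂μ = ∫ ω, deconvKernel φ σ h (X 0 ω - x) ∂μ :=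
  integral_average_eq hident (ψ := fun y => deconvKernel φ σ h (y - x))
    ((measurable_deconvKernel hφ σ h).comp (by fun_prop))
    (fun _ => abs_deconvKernel_le hint hh _) hn

/-- Split at the mean: the supremum of the kernel controls the variance, while the mean and
`scaledKernel` are both of order `1 / h`, without exponential growth. -/
theorem sqrt_integral_sq_deconvAverage_sub_le (hindep : iIndepFun X μ)
    (hident : ∀ i, IdentDistrib (X i) (X 0) μ μ)
    (hchar : ∀ t, ‖charFun (μ.map (X 0)) t‖ ≤ Real.exp (-(σ ^ 2 * t ^ 2) / 2))
    (hφ : Measurable φ) (hint : IntervalIntegrable φ volume 0 1) (hh : 0 < h) (hn : 0 < n) :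
    √(∫ ω, (deconvAverage σ φ X h n x ω - scaledKernel φ h x) ^ 2 ∂μ) ≤
      1 / (Real.pi * h) * (2 * (cosLaplace (fun s => |φ s|) (σ ^ 2 / h ^ 2) 0 / √n +
        2 * cosLaplace (fun s => |φ s|) 0 0)) := by
  have hpi := Real.pi_pos
  have hX : ∀ i, AEMeasurable (X i) μ := fun i => (hident i).aemeasurable_fst
  set M := cosLaplace (fun s => |φ s|) (σ ^ 2 / h ^ 2) 0 with hMdef
  set J := cosLaplace (fun s => |φ s|) 0 0 with hJdef
  have hM0 : 0 ≤ M := cosLaplace_abs_nonneg _ _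
  have hJ0 : 0 ≤ J := cosLaplace_abs_nonneg _ _
  set c := 1 / (Real.pi * h) with hc
  have hc0 : 0 < c := by positivity
  set E := ∫ ω, deconvKernel φ σ h (X 0 ω - x) ∂μ with hE
  have hEle : |E| ≤ c * J := by
    have : E = c * ∫ ω, cosLaplace φ (σ ^ 2 / h ^ 2) ((X 0 ω - x) / h) ∂μ := by
      rw [hE, ← integral_const_mul]
      rfl
    rw [this, abs_mul, abs_of_pos hc0]
    exact mul_le_mul_of_nonneg_left (abs_integral_cosLaplace_le hφ hint (hX 0) hchar h x) hc0.le
  have hW : |scaledKernel φ h x| ≤ c * J := abs_scaledKernel_le hint hh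
  have hvar : ∫ ω, (deconvAverage σ φ X h n x ω - E) ^ 2 ∂μ ≤ (c * M / √n) ^ 2 :=
    integral_sq_average_sub_le_sq hindep hident (ψ := fun y => deconvKernel φ σ h (y - x))
      ((measurable_deconvKernel hφ σ h).comp (by fun_prop))
      (fun _ => abs_deconvKernel_le hint hh _) hn
  have hle : ∫ ω, (deconvAverage σ φ X h n x ω - scaledKernel φ h x) ^ 2 ∂μ ≤
      ∫ ω, (2 * (deconvAverage σ φ X h n x ω - E) ^ 2 + 2 * (E - scaledKernel φ h x) ^ 2) ∂μ := by
    refine integral_mono (memLp_deconvAverage_sub hX hφ hint hh _).integrable_sq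
      (((memLp_deconvAverage_sub hX hφ hint hh _).integrable_sq.const_mul 2).add
        (integrable_const _)) fun ω => ?_
    simp only
    nlinarith [sq_nonneg ((deconvAverage σ φ X h n x ω - E) - (E - scaledKernel φ h x))]
  rw [integral_add ((memLp_deconvAverage_sub hX hφ hint hh _).integrable_sq.const_mul 2)
    (integrable_const _), integral_const_mul] at hle
  simp only [integral_const, probReal_univ, smul_eq_mul, one_mul] at hle
  have hbias : (E - scaledKernel φ h x) ^ 2 ≤ (c * (2 * J)) ^ 2 := by
    rw [← sq_abs]
    refine pow_le_pow_left₀ (abs_nonneg _) ?_ 2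
    linarith [abs_sub E (scaledKernel φ h x)]
  refine Real.sqrt_le_iff.2 ⟨by positivity, hle.trans ?_⟩
  have h1 : 0 ≤ c * M / √n := by positivity
  have h2 : 0 ≤ c * (2 * J) := by positivity
  rw [show c * (2 * (M / √n + 2 * J)) = 2 * (c * M / √n + c * (2 * J)) by ring]
  nlinarith [mul_nonneg h1 h2]

/-- The `L¹` bound for the error that is caused by the estimation of `p`. -/
theorem integral_abs_plugIn_error_le (hindep : iIndepFun X μ)
    (hident : ∀ i, IdentDistrib (X i) (X 0) μ μ)
    (hchar : ∀ t, ‖charFun (μ.map (X 0)) t‖ ≤ Real.exp (-(σ ^ 2 * t ^ 2) / 2))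
    (hφ : Measurable φ) (hint : IntervalIntegrable φ volume 0 1) (hφk : Measurable φk)
    (hintk : IntervalIntegrable φk volume (-1) 1) (hsymm : ∀ t, φk (-t) = φk t)
    (hh : 0 < h) (hg : 0 < g) (hε : 0 < ε) (hn : 0 < n) {m : ℝ} (hm1 : m ≤ 1 - ε)
    (hm : m = ∫ ω, cosLaplace φk (σ ^ 2 / g ^ 2) (X 0 ω / g) ∂μ) :
    Integrable (fun ω => (1 / (1 - pEstTrunc σ φk X g ε n ω) - 1 / (1 - m)) *
      (deconvAverage σ φ X h n x ω - scaledKernel φ h x)) μ ∧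
    ∫ ω, |(1 / (1 - pEstTrunc σ φk X g ε n ω) - 1 / (1 - m)) *
      (deconvAverage σ φ X h n x ω - scaledKernel φ h x)| ∂μ ≤
      1 / (ε * (1 - m)) * (cosLaplace (fun s => |φk s|) (σ ^ 2 / g ^ 2) 0 / √n *
        (1 / (Real.pi * h) * (2 * (cosLaplace (fun s => |φ s|) (σ ^ 2 / h ^ 2) 0 / √n +
          2 * cosLaplace (fun s => |φ s|) 0 0)))) := by
  have hX : ∀ i, AEMeasurable (X i) μ := fun i => (hident i).aemeasurable_fst
  have hintk0 : IntervalIntegrable φk volume 0 1 :=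
    hintk.mono_set (by rw [Set.uIcc_of_le (by norm_num), Set.uIcc_of_le (by norm_num)]
                       exact Set.Icc_subset_Icc_left (by norm_num))
  have h1m : 0 < 1 - m := by linarith
  set Mk := cosLaplace (fun s => |φk s|) (σ ^ 2 / g ^ 2) 0 with hMk
  have hMk0 : 0 ≤ Mk := cosLaplace_abs_nonneg _ _
  have hψ : Measurable fun y => cosLaplace φk (σ ^ 2 / g ^ 2) (y / g) :=
    (measurable_cosLaplace hφk _).comp (by fun_prop)
  have hP : ∀ ω, pEst σ φk X g n ω =
      1 / (n : ℝ) * ∑ j ∈ Finset.range n, cosLaplace φk (σ ^ 2 / g ^ 2) (X j ω / g) :=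
    fun ω => pEst_eq hg hintk hsymm X n ω
  have hPm : MemLp (fun ω => pEst σ φk X g n ω - m) 2 μ := by
    simp only [hP]
    refine MemLp.of_bound (((Finset.aemeasurable_fun_sum _ fun j _ =>
      hψ.comp_aemeasurable (hX j)).const_mul _).sub_const m).aestronglyMeasurable (Mk + |m|)
      (ae_of_all _ fun ω => (norm_sub_le _ _).trans (add_le_add_left ?_ _))
    exact abs_average_le hMk0 (fun y => abs_cosLaplace_le hintk0 _ (y / g)) fun j => X j ω
  have hS := memLp_deconvAverage_sub (σ := σ) (n := n) (x := x) hX hφ hint hh (scaledKernel φ h x)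
  have hprod : Integrable (fun ω => 1 / (ε * (1 - m)) * |(pEst σ φk X g n ω - m) *
      (deconvAverage σ φ X h n x ω - scaledKernel φ h x)|) μ :=
    (hPm.integrable_mul hS).abs.const_mul _
  have hpt : ∀ ω, |(1 / (1 - pEstTrunc σ φk X g ε n ω) - 1 / (1 - m)) *
      (deconvAverage σ φ X h n x ω - scaledKernel φ h x)| ≤
      1 / (ε * (1 - m)) * |(pEst σ φk X g n ω - m) *
      (deconvAverage σ φ X h n x ω - scaledKernel φ h x)| := fun ω => by
    rw [abs_mul, abs_mul, ← mul_assoc]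
    exact mul_le_mul_of_nonneg_right (abs_one_div_sub_one_div_le hε hm1) (abs_nonneg _)
  constructor
  · refine hprod.mono' ?_ (ae_of_all _ hpt)
    exact ((((aemeasurable_pEstTrunc hX hφk g ε n).const_sub 1).const_div 1 |>.sub_const _).mul
      ((aemeasurable_deconvAverage hX hφ).sub_const _)).aestronglyMeasurable
  · refine (integral_mono_of_nonneg (ae_of_all _ fun ω => abs_nonneg _) hprod
      (ae_of_all _ hpt)).trans ?_
    rw [integral_const_mul]
    refine mul_le_mul_of_nonneg_left ?_ (by positivity)
    -- Both factors come from the same sample, so they are separated by Cauchy–Schwarz rather than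
    -- by independence.
    refine (integral_abs_mul_le hPm hS).trans ?_
    refine mul_le_mul ?_ (sqrt_integral_sq_deconvAverage_sub_le hindep hident hchar hφ hint hh hn)
      (Real.sqrt_nonneg _) (by positivity)
    refine Real.sqrt_le_iff.2 ⟨by positivity, ?_⟩
    simp only [hP]
    rw [hm]
    exact integral_sq_average_sub_le_sq hindep hident hψ
      (fun y => abs_cosLaplace_le hintk0 _ (y / g)) hn

/-- The `L¹` bound for a centred and normalized sum. -/
theorem integral_abs_sqrt_mul_average_sub_le (hindep : iIndepFun X μ)
    (hident : ∀ i, IdentDistrib (X i) (X 0) μ μ) {ψ : ℝ → ℝ} (hψ : Measurable ψ) {M : ℝ}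
    (hM0 : 0 ≤ M) (hM : ∀ y, |ψ y| ≤ M) (hn : 0 < n) :
    Integrable (fun ω => √n * (1 / (n : ℝ) * ∑ j ∈ Finset.range n, ψ (X j ω) -
      ∫ ω', ψ (X 0 ω') ∂μ)) μ ∧
    ∫ ω, |√n * (1 / (n : ℝ) * ∑ j ∈ Finset.range n, ψ (X j ω) - ∫ ω', ψ (X 0 ω') ∂μ)| ∂μ ≤
      √(∫ ω, ψ (X 0 ω) ^ 2 ∂μ) := by
  have hn' : (0 : ℝ) < n := Nat.cast_pos.2 hn
  have hX : ∀ i, AEMeasurable (X i) μ := fun i => (hident i).aemeasurable_fst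
  have hmem : MemLp (fun ω => √n * (1 / (n : ℝ) * ∑ j ∈ Finset.range n, ψ (X j ω) -
      ∫ ω', ψ (X 0 ω') ∂μ)) 2 μ := by
    refine MemLp.const_mul (MemLp.of_bound (((Finset.aemeasurable_fun_sum _ fun j _ =>
      hψ.comp_aemeasurable (hX j)).const_mul _).sub_const _).aestronglyMeasurable
      (M + |∫ ω', ψ (X 0 ω') ∂μ|)
      (ae_of_all _ fun ω => (norm_sub_le _ _).trans (add_le_add_left ?_ _))) _
    exact abs_average_le hM0 hM fun j => X j ω
  refine ⟨hmem.integrable one_le_two, (integral_abs_le_sqrt hmem).trans (Real.sqrt_le_sqrt ?_)⟩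
  simp only [mul_pow, Real.sq_sqrt hn'.le]
  rw [integral_const_mul]
  refine (mul_le_mul_of_nonneg_left (integral_sq_average_sub_le hindep hident hψ hM hn)
    hn'.le).trans (le_of_eq ?_)
  field_simp

end Errors

/-! ### Asymptotic normality of the plug-in estimator -/

theorem integral_zero_one_eq_one {φ : ℝ → ℝ} (hint : IntervalIntegrable φ volume (-1) 1)
    (hsymm : ∀ t, φ (-t) = φ t) (hsupp : Function.support φ ⊆ Set.Icc (-1) 1)
    (htwo : ∫ t, φ t = 2) : ∫ s in (0 : ℝ)..1, φ s = 1 := by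
  have h1 := re_intervalIntegral_eq_two_mul (G := fun s => (φ s : ℂ)) (r := φ)
    (by rw [intervalIntegrable_iff] at hint ⊢; exact hint.ofReal) (fun _ => rfl) hsymm
  rw [intervalIntegral.integral_ofReal, Complex.ofReal_re] at h1
  have h2 : ∫ s in (-1 : ℝ)..1, φ s = ∫ t, φ t := by
    rw [intervalIntegral.integral_of_le (by norm_num), ← integral_Icc_eq_integral_Ioc]
    refine setIntegral_eq_integral_of_forall_compl_eq_zero fun s hs => ?_
    by_contra hne
    exact hs (hsupp hne)
  rw [h2, htwo] at h1
  linarith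

theorem KernelConditionW.intervalIntegrable {φw : ℝ → ℝ} {A α γ : ℝ}
    (hw : KernelConditionW φw A α γ) (a b : ℝ) : IntervalIntegrable φw volume a b := by
  obtain ⟨M, hM⟩ := hw.bounded
  refine (intervalIntegrable_const (c := M)).mono_fun
    hw.measurable.aestronglyMeasurable (ae_of_all _ fun t => ?_)
  rw [Real.norm_eq_abs]
  exact (hM t).trans (le_abs_self M)

/-- One factor `N Mk / ε = (N / N' / ε) (N' Mk)` tends to zero; the other is bounded because `M / √n
= N M / (√n N)` and `√n N ≥ 1`. -/
theorem tendsto_plugIn_error_bound {κ J : ℝ} {N M Mk N' ε m : ℕ → ℝ} {a b p : ℝ} (hp1 : p < 1)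
    (hm : Tendsto m atTop (𝓝 p)) (hM : Tendsto (fun n => N n * M n) atTop (𝓝 a))
    (hMk : Tendsto (fun n => N' n * Mk n) atTop (𝓝 b)) (hN' : ∀ᶠ n in atTop, 0 < N' n)
    (hN : ∀ᶠ n : ℕ in atTop, 1 ≤ √n * N n)
    (hratio : Tendsto (fun n => N n / N' n / ε n) atTop (𝓝 0)) :
    Tendsto (fun n : ℕ => √n * (κ * N n) * (1 / (ε n * (1 - m n)) *
      (Mk n / √n * (2 * (M n / √n + 2 * J))))) atTop (𝓝 0) := by
  have hbdd : IsBoundedUnder (· ≤ ·) atTop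
      fun n : ℕ => ‖N n * M n * (√n * N n)⁻¹‖ := by
    refine isBoundedUnder_of_eventually_le (a := |a| + 1) ?_
    filter_upwards [hN, hM.abs.eventually_le_const (show |a| < |a| + 1 by linarith)] with n h1 h2
    rw [norm_mul, norm_inv, Real.norm_eq_abs, Real.norm_of_nonneg (by linarith : 0 ≤ √n * N n)]
    have := inv_le_one_of_one_le₀ h1
    have h3 : 0 ≤ (√n * N n)⁻¹ := inv_nonneg.2 (by linarith)
    nlinarith [abs_nonneg (N n * M n)]
  have h1m : Tendsto (fun n => (1 - m n)⁻¹) atTop (𝓝 (1 - p)⁻¹) :=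
    (hm.const_sub 1).inv₀ (by linarith)
  have h1 : Tendsto (fun n => N n / N' n / ε n * (N' n * Mk n) * (1 - m n)⁻¹) atTop (𝓝 0) := by
    have := (hratio.mul hMk).mul h1m
    rwa [zero_mul, zero_mul] at this
  have h2 := h1.zero_mul_isBoundedUnder_le hbdd
  have h3 := (h2.const_mul (2 * κ)).add (h1.const_mul (4 * κ * J))
  rw [mul_zero, mul_zero, add_zero] at h3
  refine h3.congr' ?_
  filter_upwards [hN, hN', eventually_gt_atTop 0] with n h4 h5 hn
  have hs : 0 < √(n : ℝ) := Real.sqrt_pos.2 (Nat.cast_pos.2 hn)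
  have hNn : N n ≠ 0 := by
    rintro h0
    rw [h0, mul_zero] at h4
    linarith
  simp only [div_eq_mul_inv, mul_inv, one_mul]
  field_simp
  ring

/-! ### Splitting the normalized error into a cosine sum and two remainders -/

section Decomposition

variable {Ω : Type*} [MeasurableSpace Ω] {μ : Measure Ω} [IsProbabilityMeasure μ]
  {X : ℕ → Ω → ℝ} {φ φk : ℝ → ℝ} {σ x α h g ε m : ℝ} {n : ℕ}

/-- An exact identity: `R` is the cost of freezing the cosine and `Q` that of replacing the
truncated estimator by `m`. The term `scaledKernel` is deterministic and disappears on centring. -/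
theorem normalized_plugIn_sub_cos_sum_eq (hident : ∀ i, IdentDistrib (X i) (X 0) μ μ)
    (hσ : 0 < σ) (hφ : Measurable φ) (hint : IntervalIntegrable φ volume (-1) 1)
    (hsymm : ∀ t, φ (-t) = φ t) (hsupp : Function.support φ ⊆ Set.Icc (-1) 1)
    (hh : 0 < h) (hε : 0 < ε) (hn : 0 < n) {Q : Ω → ℝ}
    (hQ : Q = fun ω => (1 / (1 - pEstTrunc σ φk X g ε n ω) - 1 / (1 - m)) *
      (deconvAverage σ φ X h n x ω - scaledKernel φ h x)) (hQint : Integrable Q μ)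
    {a c L : ℝ} (ha : a = √n / (h ^ (1 + 2 * α) * Real.exp (σ ^ 2 / (2 * h ^ 2))))
    (hc : c = (1 / σ ^ 2) ^ (1 + α) / Real.pi *
      ((σ ^ 2 / h ^ 2) ^ (1 + α) * Real.exp (-(σ ^ 2 / h ^ 2) / 2)) / (1 - m))
    {R : ℝ → ℝ} (hR : R = fun y => c * (cosLaplace φ (σ ^ 2 / h ^ 2) ((y - x) / h) -
      Real.cos ((y - x) / h) * L)) (ω : Ω) :
    a * (plugInDensityEst σ φ φk X h g ε n x ω -
        ∫ ω', plugInDensityEst σ φ φk X h g ε n x ω' ∂μ) -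
      (√n)⁻¹ * ∑ j ∈ Finset.range n, c * L * (Real.cos (h⁻¹ * (X j ω - x)) -
        ∫ ω', Real.cos (h⁻¹ * (X 0 ω' - x)) ∂μ) =
      √n * (1 / (n : ℝ) * ∑ j ∈ Finset.range n, R (X j ω) - ∫ ω', R (X 0 ω') ∂μ) +
        a * (Q ω - ∫ ω', Q ω' ∂μ) := by
  have hn' : (0 : ℝ) < n := Nat.cast_pos.2 hn
  have hX : ∀ i, AEMeasurable (X i) μ := fun i => (hident i).aemeasurable_fst
  have hint0 : IntervalIntegrable φ volume 0 1 :=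
    hint.mono_set (by rw [Set.uIcc_of_le (by norm_num), Set.uIcc_of_le (by norm_num)]
                      exact Set.Icc_subset_Icc_left (by norm_num))
  have hf : ∀ ω, plugInDensityEst σ φ φk X h g ε n x ω =
      (deconvAverage σ φ X h n x ω - scaledKernel φ h x) / (1 - m) + scaledKernel φ h x + Q ω :=
    fun ω => by
      rw [plugInDensityEst_eq hh hε hint hsymm hsupp, hQ]
      ring
  have hSint : Integrable (fun ω => deconvAverage σ φ X h n x ω - scaledKernel φ h x) μ :=
    (memLp_deconvAverage_sub hX hφ hint0 hh _).integrable one_le_two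
  have hSint' : Integrable (fun ω => deconvAverage σ φ X h n x ω) μ := by
    simpa using (memLp_deconvAverage_sub (σ := σ) (n := n) (x := x) hX hφ hint0 hh 0).integrable
      one_le_two
  have hLint : Integrable (fun ω => cosLaplace φ (σ ^ 2 / h ^ 2) ((X 0 ω - x) / h)) μ :=
    Integrable.of_bound (((measurable_cosLaplace hφ _).comp
      (show Measurable fun y : ℝ => (y - x) / h by fun_prop)).comp_aemeasurable
        (hX 0)).aestronglyMeasurable _ (ae_of_all _ fun ω => abs_cosLaplace_le hint0 _ _)
  have hCint : Integrable (fun ω => Real.cos ((X 0 ω - x) / h)) μ :=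
    Integrable.of_bound (by have := hX 0; fun_prop) 1
      (ae_of_all _ fun ω => Real.abs_cos_le_one _)
  have hEf : ∫ ω', plugInDensityEst σ φ φk X h g ε n x ω' ∂μ =
      (1 / (Real.pi * h) * ∫ ω', cosLaplace φ (σ ^ 2 / h ^ 2) ((X 0 ω' - x) / h) ∂μ -
        scaledKernel φ h x) / (1 - m) + scaledKernel φ h x + ∫ ω', Q ω' ∂μ := by
    have hSint2 : Integrable (fun ω => (deconvAverage σ φ X h n x ω - scaledKernel φ h x) /
        (1 - m) + scaledKernel φ h x) μ := (hSint.div_const _).add (integrable_const _)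
    simp only [hf]
    rw [integral_add hSint2 hQint,
      integral_add (hSint.div_const _) (integrable_const _), integral_div,
      integral_sub hSint' (integrable_const _), integral_deconvAverage hident hφ hint0 hh hn]
    simp only [deconvKernel]
    rw [integral_const_mul]
    simp
  have hER : ∫ ω', R (X 0 ω') ∂μ =
      c * (∫ ω', cosLaplace φ (σ ^ 2 / h ^ 2) ((X 0 ω' - x) / h) ∂μ -
        (∫ ω', Real.cos ((X 0 ω' - x) / h) ∂μ) * L) := by
    simp only [hR]
    rw [integral_const_mul, integral_sub hLint (hCint.mul_const _), integral_mul_const]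
  have hSR : ∑ j ∈ Finset.range n, R (X j ω) =
      c * (∑ j ∈ Finset.range n, cosLaplace φ (σ ^ 2 / h ^ 2) ((X j ω - x) / h) -
        (∑ j ∈ Finset.range n, Real.cos ((X j ω - x) / h)) * L) := by
    simp only [hR]
    rw [← Finset.mul_sum, Finset.sum_sub_distrib, Finset.sum_mul]
  have hS : deconvAverage σ φ X h n x ω = 1 / (Real.pi * h) *
      (1 / (n : ℝ) * ∑ j ∈ Finset.range n, cosLaplace φ (σ ^ 2 / h ^ 2) ((X j ω - x) / h)) := by
    simp only [deconvAverage, deconvKernel]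
    rw [← Finset.mul_sum]
    ring
  have hnorm := normalization_mul_eq hσ hh α n
  rw [← ha] at hnorm
  have hac : a * (1 / (Real.pi * h)) / (1 - m) = √n * c := by
    rw [hnorm, hc]
    ring
  rw [hEf, hER, hSR, hf, hS, ← Finset.mul_sum, Finset.sum_sub_distrib, Finset.sum_const,
    Finset.card_range, nsmul_eq_mul]
  simp only [inv_mul_eq_div]
  generalize ∑ j ∈ Finset.range n, cosLaplace φ (σ ^ 2 / h ^ 2) ((X j ω - x) / h) = SL
  generalize ∫ ω', cosLaplace φ (σ ^ 2 / h ^ 2) ((X 0 ω' - x) / h) ∂μ = EL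
  generalize ∑ j ∈ Finset.range n, Real.cos ((X j ω - x) / h) = SC
  generalize ∫ ω', Real.cos ((X 0 ω' - x) / h) ∂μ = EC
  have hsq : (√(n : ℝ))⁻¹ = √n * (1 / (n : ℝ)) := by
    have hs : √(n : ℝ) ≠ 0 := (Real.sqrt_pos.2 hn').ne'
    have := Real.mul_self_sqrt hn'.le
    field_simp
    rw [sq, this]
  rw [div_eq_inv_mul (c * L * (SC - n * EC)), hsq]
  have hnn : 1 / (n : ℝ) * n = 1 := one_div_mul_cancel hn'.ne'
  linear_combination (1 / (n : ℝ) * SL - EL) * hac + √n * c * L * EC * hnn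

/-- Truncation keeps the denominator above `ε`, so for fixed `n` the estimator is bounded. -/
theorem integrable_plugInDensityEst (hX : ∀ i, AEMeasurable (X i) μ) (hφ : Measurable φ)
    (hφk : Measurable φk) (hint : IntervalIntegrable φ volume (-1) 1)
    (hsymm : ∀ t, φ (-t) = φ t) (hsupp : Function.support φ ⊆ Set.Icc (-1) 1)
    (hh : 0 < h) (hε : 0 < ε) : Integrable (plugInDensityEst σ φ φk X h g ε n x) μ := by
  have hint0 : IntervalIntegrable φ volume 0 1 :=
    hint.mono_set (by rw [Set.uIcc_of_le (by norm_num), Set.uIcc_of_le (by norm_num)]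
                      exact Set.Icc_subset_Icc_left (by norm_num))
  set B := 1 / (Real.pi * h) * cosLaplace (fun s => |φ s|) (σ ^ 2 / h ^ 2) 0
  refine Integrable.of_bound (aemeasurable_plugInDensityEst hX hφ hφk h g ε n x).aestronglyMeasurable
    ((B + |scaledKernel φ h x|) / ε + |scaledKernel φ h x|) (ae_of_all _ fun ω => ?_)
  rw [plugInDensityEst_eq hh hε hint hsymm hsupp]
  have h1 : ε ≤ 1 - pEstTrunc σ φk X g ε n ω := by
    have : pEstTrunc σ φk X g ε n ω ≤ 1 - ε := min_le_right _ _
    linarith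
  refine (norm_add_le _ _).trans (add_le_add ?_ le_rfl)
  rw [norm_div, Real.norm_eq_abs, Real.norm_of_nonneg (hε.le.trans h1)]
  have h2 : |deconvAverage σ φ X h n x ω - scaledKernel φ h x| ≤ B + |scaledKernel φ h x| :=
    (abs_sub _ _).trans (add_le_add (abs_deconvAverage_le hint0 hh ω) le_rfl)
  have h3 := (abs_nonneg _).trans h2
  gcongr

end Decomposition

/-! ### Assembling the limit law -/

theorem theorem2p5 {Ω : Type*} [MeasurableSpace Ω] (μ : Measure Ω) [IsProbabilityMeasure μ]
    (p σ : ℝ) (hp0 : 0 ≤ p) (hp1 : p < 1) (hσ : 0 < σ)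
    (f : ℝ → ℝ) (hf_meas : Measurable f) (hf_nonneg : ∀ v, 0 ≤ f v)
    (U V Z X : ℕ → Ω → ℝ) (hX : IsAtomicDeconvolutionSample μ p σ f U V Z X)
    (hX2 : Integrable (fun ω => X 0 ω ^ 2) μ)
    (φw φk : ℝ → ℝ) (A B C α γ : ℝ) (η δ ε : ℕ → ℝ)
    (hf : DensityCondition f γ)
    (hw : KernelConditionW φw A α γ)
    (hk : KernelConditionK φk B C α γ)
    (hb : BandwidthCondition η δ α)
    (hε : TruncationCondition ε η δ)
    (h g : ℕ → ℝ) (hh : ∀ n, h n = bandwidth σ η n) (hg : ∀ n, g n = bandwidth σ δ n)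
    (x : ℝ) :
    (∀ᶠ n in atTop, Integrable (plugInDensityEst σ φw φk X (h n) (g n) (ε n) n x) μ) ∧
    TendstoInDistribution
      (fun (n : ℕ) (ω : Ω) =>
        Real.sqrt n / (h n ^ (1 + 2 * α) * Real.exp (σ ^ 2 / (2 * h n ^ 2))) *
          (plugInDensityEst σ φw φk X (h n) (g n) (ε n) n x ω -
            ∫ ω', plugInDensityEst σ φw φk X (h n) (g n) (ε n) n x ω' ∂μ))
      atTop (id : ℝ → ℝ) (fun _ => μ)
      (gaussianReal 0 (Real.toNNReal
        (A ^ 2 / (2 * Real.pi ^ 2 * (1 - p) ^ 2) * (1 / σ ^ 2) ^ (2 + 2 * α) *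
          Real.Gamma (α + 1) ^ 2))) := by
  have hη0 := hb.eta_decr.2
  have hδ0 := hb.delta_decr.2
  have hα := hw.alpha_nonneg
  have hident := hX.identDistrib_obs hp0 hp1.le
  have hindep := hX.indep_X
  have hXm := hX.aemeasurable_obs
  have hchar := hX.norm_charFun_obs_le hp0 hp1.le 0
  have : IsProbabilityMeasure (densityLaw f) :=
    (hX.law_V 0).isProbabilityMeasure_iff.1 inferInstance
  have hintw := hw.intervalIntegrable
  have hintk : ∀ a b, IntervalIntegrable φk volume a b := fun a b => hk.integrable.intervalIntegrable
  obtain rfl : h = bandwidth σ η := funext hh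
  obtain rfl : g = bandwidth σ δ := funext hg
  set h := bandwidth σ η
  set g := bandwidth σ δ
  have hh0 : Tendsto h atTop (𝓝[>] 0) := tendsto_bandwidth hσ hη0
  have hg0 : Tendsto g atTop (𝓝[>] 0) := tendsto_bandwidth hσ hδ0
  have hhpos : ∀ᶠ n in atTop, 0 < h n := (tendsto_nhdsWithin_iff.1 hh0).2
  have hgpos : ∀ᶠ n in atTop, 0 < g n := (tendsto_nhdsWithin_iff.1 hg0).2
  set l : ℕ → ℝ := fun n => σ ^ 2 / h n ^ 2 with hl_def
  set lg : ℕ → ℝ := fun n => σ ^ 2 / g n ^ 2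
  have hl : Tendsto l atTop atTop := tendsto_sq_div_bandwidth_sq hσ hη0
  have hlg : Tendsto lg atTop atTop := tendsto_sq_div_bandwidth_sq hσ hδ0
  set κ : ℝ := (1 / σ ^ 2) ^ (1 + α) / Real.pi with hκ
  set N : ℕ → ℝ := fun n => l n ^ (1 + α) * Real.exp (-l n / 2) with hN
  set N' : ℕ → ℝ := fun n => lg n ^ (1 + α) * Real.exp (-lg n / 2) with hN'
  set M : ℕ → ℝ := fun n => cosLaplace (fun s => |φw s|) (l n) 0 with hM
  set Mk : ℕ → ℝ := fun n => cosLaplace (fun s => |φk s|) (lg n) 0 with hMk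
  set J : ℝ := cosLaplace (fun s => |φw s|) 0 0
  set m : ℕ → ℝ := fun n => ∫ ω, cosLaplace φk (lg n) (X 0 ω / g n) ∂μ with hm
  set c : ℕ → ℝ := fun n => κ * N n / (1 - m n) with hc
  set L : ℕ → ℝ := fun n => cosLaplace φw (l n) 0 with hL
  set L' : ℕ → ℝ := fun n => cosLaplace (fun s => |φw s| * (1 - s)) (l n) 0 with hL'
  have hm_lim : Tendsto m atTop (𝓝 p) :=
    tendsto_integral_cosLaplace hk.measurable (hintk 0 1)
      (integral_zero_one_eq_one (hintk _ _) hk.symm hk.support_subset hk.integral_eq) (hXm 0)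
      norm_charFun_le_one measurable_charFun (tendsto_charFun_densityLaw hf_meas hf_nonneg)
      (hX.charFun_obs hp0 hp1.le 0) hg0
  have hNL : Tendsto (fun n => N n * L n) atTop (𝓝 (A * Real.Gamma (α + 1))) :=
    (tendsto_cosLaplace hα hw.measurable (hintw 0 1) hw.at_one).comp hl
  have hNM : Tendsto (fun n => N n * M n) atTop (𝓝 (|A| * Real.Gamma (α + 1))) :=
    (tendsto_cosLaplace_abs hα hw.measurable (hintw 0 1) hw.at_one).comp hl
  have hNMk : Tendsto (fun n => N' n * Mk n) atTop (𝓝 (|C| * Real.Gamma (α + 1))) :=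
    (tendsto_cosLaplace_abs hα hk.measurable (hintk 0 1) hk.at_one).comp hlg
  have h1m : Tendsto (fun n => (1 - m n)⁻¹) atTop (𝓝 (1 - p)⁻¹) :=
    (hm_lim.const_sub 1).inv₀ (by linarith)
  have hcL : Tendsto (fun n => c n * L n) atTop
      (𝓝 (κ * (A * Real.Gamma (α + 1)) * (1 - p)⁻¹)) := by
    refine ((hNL.const_mul κ).mul h1m).congr fun n => ?_
    simp only [hc]
    ring
  -- The integral `L'` gains a factor of order `1 / l = h² / σ²`, so one power of `h` survives the
  -- division by `h`.
  have hrem : Tendsto (fun n => |c n| * L' n / h n) atTop (𝓝 0) := by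
    have h1 := ((tendsto_cosLaplace_abs_mul_one_sub hα hw.measurable (hintw 0 1) hw.at_one).comp
      hl).mul (((tendsto_nhdsWithin_iff.1 hh0).1.div_const (σ ^ 2)).mul
        ((h1m.const_mul κ).abs))
    rw [zero_div, zero_mul, mul_zero] at h1
    refine h1.congr' ?_
    filter_upwards [hhpos, hl.eventually_gt_atTop 0] with n hn hln
    have hN0 : 0 < N n := mul_pos (Real.rpow_pos_of_pos hln _) (Real.exp_pos _)
    have hcn : |c n| = N n * |κ * (1 - m n)⁻¹| := by
      rw [show c n = N n * (κ * (1 - m n)⁻¹) by simp only [hc]; ring, abs_mul, abs_of_pos hN0]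
    have hexp : l n ^ (1 + (α + 1)) = l n ^ (1 + α) * l n := by
      rw [← add_assoc, Real.rpow_add_one hln.ne']
    have hlh : l n * (h n / σ ^ 2) = (h n)⁻¹ := by
      simp only [hl_def]
      field_simp
    rw [hcn]
    simp only [Function.comp, hexp]
    rw [show ∀ a b d e u w : ℝ, a * b * d * e * (u * w) = (a * d * e * w) * (b * u) by
      intros; ring, hlh]
    simp only [hN, hL']
    ring
  have hε0 : ∀ᶠ n in atTop, 0 < ε n := hε.mem_Ioo.mono fun n hn => hn.1
  -- Since `m + ε → p < 1`, truncation eventually leaves `m` unchanged.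
  have hmε : ∀ᶠ n in atTop, m n ≤ 1 - ε n := by
    have h1 := hm_lim.add hε.decr.2
    rw [add_zero] at h1
    filter_upwards [h1.eventually_le_const hp1] with n hn
    linarith
  have hleq : ∀ᶠ n in atTop, l n = (1 + η n) * Real.log n := eventually_sq_div_bandwidth_sq hσ hη0
  have hlgeq : ∀ᶠ n in atTop, lg n = (1 + δ n) * Real.log n := eventually_sq_div_bandwidth_sq hσ hδ0
  have hratio : Tendsto (fun n => N n / N' n / ε n) atTop (𝓝 0) := by
    refine (tendsto_scale_ratio hη0 hδ0 hb.diff_log hε0 hε.log_ratio α).congr' ?_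
    filter_upwards [hleq, hlgeq] with n h1 h2
    simp only [hN, hN', h1, h2]
  have hNlow : ∀ᶠ n : ℕ in atTop, 1 ≤ √n * N n := by
    filter_upwards [hleq, eventually_one_le_sqrt_mul_scale hα hη0 hb.eta_log] with n h1 h2
    simpa only [hN, h1] using h2
  have hN'pos : ∀ᶠ n in atTop, 0 < N' n := by
    filter_upwards [hlg.eventually_gt_atTop 0] with n hn
    exact mul_pos (Real.rpow_pos_of_pos hn _) (Real.exp_pos _)
  have hplug := tendsto_plugIn_error_bound (κ := κ) (J := J) hp1 hm_lim hNM hNMk hN'pos hNlow hratio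
  refine ⟨?_, ?_⟩
  · filter_upwards [hhpos, hε0] with n hn hεn
    exact integrable_plugInDensityEst hXm hw.measurable hk.measurable (hintw _ _) hw.symm
      hw.support_subset hn hεn
  set ψ : ℕ → ℝ → ℝ := fun n y => c n * L n * (Real.cos ((h n)⁻¹ * (y - x)) -
    ∫ ω, Real.cos ((h n)⁻¹ * (X 0 ω - x)) ∂μ) with hψ
  have hcosint : ∀ u : ℝ, Integrable (fun ω => Real.cos (u * (X 0 ω - x))) μ := fun u =>
    Integrable.of_bound (by have := hXm 0; fun_prop) 1
      (ae_of_all _ fun ω => Real.abs_cos_le_one _)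
  have hinv : Tendsto (fun n => (h n)⁻¹) atTop atTop := tendsto_inv_nhdsGT_zero.comp hh0
  have hclt := tendstoInDistribution_inv_sqrt_mul_sum_of_bounded hindep hident (ψ := ψ)
    -- The coefficient `c L` is eventually within `1` of its limit in absolute value; a centred
    -- cosine is at most `2`. The `1 / 2` in `v` is the limiting variance of the cosine.
    (M := (|κ * (A * Real.Gamma (α + 1)) * (1 - p)⁻¹| + 1) * 2)
    (v := (κ * (A * Real.Gamma (α + 1)) * (1 - p)⁻¹) ^ 2 * (1 / 2))
    (fun n => by simp only [hψ]; fun_prop) ?_ ?_ ?_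
  rotate_left
  · filter_upwards [hcL.abs.eventually_le_const (lt_add_one _)] with n hn y
    simp only [hψ]
    rw [abs_mul]
    refine mul_le_mul hn ?_ (abs_nonneg _) (by positivity)
    refine (abs_sub _ _).trans ?_
    have h1 := Real.abs_cos_le_one ((h n)⁻¹ * (y - x))
    have h2 := (abs_integral_cos_mul_sub_le (hXm 0) (h n)⁻¹ x).trans ((hchar _).trans
      (Real.exp_le_one_iff.2 (by nlinarith [sq_nonneg (σ * (h n)⁻¹)])))
    linarith
  · refine Eventually.of_forall fun n => ?_
    simp only [hψ]
    rw [integral_const_mul, integral_sub (hcosint _) (integrable_const _)]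
    simp
  · simp only [hψ, mul_pow]
    simp only [integral_const_mul]
    simp only [← mul_pow]
    exact (hcL.pow 2).mul (tendsto_integral_sq_cos_sub (hXm 0) hσ hchar x hinv)
  have hvar : (κ * (A * Real.Gamma (α + 1)) * (1 - p)⁻¹) ^ 2 * (1 / 2) =
      A ^ 2 / (2 * Real.pi ^ 2 * (1 - p) ^ 2) * (1 / σ ^ 2) ^ (2 + 2 * α) *
        Real.Gamma (α + 1) ^ 2 := by
    have h1 : (1 / σ ^ 2) ^ (2 + 2 * α) = ((1 / σ ^ 2) ^ (1 + α)) ^ 2 := by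
      rw [← Real.rpow_mul_natCast (by positivity)]
      congr 1
      push_cast
      ring
    rw [h1, hκ]
    have := Real.pi_ne_zero
    have h2 : 1 - p ≠ 0 := by linarith
    field_simp
  rw [hvar] at hclt
  -- Slutsky's argument: the cosine sum has the required limit, so it suffices that the difference
  -- tends to zero in measure.
  refine tendstoInDistribution_of_tendstoInMeasure_sub _ _ hclt ?_ fun n =>
    ((aemeasurable_plugInDensityEst hXm hw.measurable hk.measurable _ _ _ n x).sub_const _).const_mul _
  set D : ℝ := √(∫ ω, (X 0 ω - x) ^ 2 ∂μ)
  have hXx : Integrable (fun ω => (X 0 ω - x) ^ 2) μ := by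
    have h1 : MemLp (X 0) 2 μ := (memLp_two_iff_integrable_sq (hXm 0).aestronglyMeasurable).2 hX2
    exact (h1.sub (memLp_const x)).integrable_sq
  -- The first term bounds the frozen-cosine remainder through the L² norm `D` of `X 0 - x`, the
  -- second the plug-in error; its factor `2` comes from centring `Q`.
  refine tendstoInMeasure_zero_of_integral_abs_le (b := fun n : ℕ => |c n| * L' n / h n * D +
    2 * (√n * (κ * N n) * (1 / (ε n * (1 - m n)) *
      (Mk n / √n * (2 * (M n / √n + 2 * J)))))) ?_ ?_
  · filter_upwards [hhpos, hgpos, hε0, hmε, eventually_gt_atTop 0] with n hn hgn hεn hmn hn0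
    obtain ⟨hQint, hQle⟩ := integral_abs_plugIn_error_le (x := x) hindep hident hchar hw.measurable
      (hintw 0 1) hk.measurable (hintk _ _) hk.symm hn hgn hεn hn0 hmn rfl
    set Q : Ω → ℝ := fun ω => (1 / (1 - pEstTrunc σ φk X (g n) (ε n) n ω) - 1 / (1 - m n)) *
      (deconvAverage σ φw X (h n) n x ω - scaledKernel φw (h n) x) with hQ
    set a : ℝ := √n / (h n ^ (1 + 2 * α) * Real.exp (σ ^ 2 / (2 * h n ^ 2))) with ha
    set R : ℝ → ℝ := fun y => c n * (cosLaplace φw (l n) ((y - x) / h n) -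
      Real.cos ((y - x) / h n) * L n) with hR
    have ha0 : 0 ≤ a := by positivity
    have hRle : ∀ y, |R y| ≤ |c n| * L' n / h n * |y - x| := fun y => by
      simp only [hR]
      rw [abs_mul]
      refine (mul_le_mul_of_nonneg_left (abs_cosLaplace_sub_le (hintw 0 1) (l n) ((y - x) / h n))
        (abs_nonneg _)).trans (le_of_eq ?_)
      rw [abs_div (y - x), abs_of_pos hn]
      simp only [hL']
      ring
    have hL'0 : 0 ≤ L' n := by
      simp only [hL', cosLaplace_zero]
      refine intervalIntegral.integral_nonneg zero_le_one fun s hs => ?_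
      have := sub_nonneg.2 hs.2
      positivity
    have hRbd : ∀ y, |R y| ≤ |c n| * (M n + |L n|) := fun y => by
      simp only [hR]
      rw [abs_mul]
      refine mul_le_mul_of_nonneg_left ((abs_sub _ _).trans (add_le_add
        (abs_cosLaplace_le (hintw 0 1) _ _) ?_)) (abs_nonneg _)
      rw [abs_mul]
      exact mul_le_of_le_one_left (abs_nonneg _) (Real.abs_cos_le_one _)
    have hRm : Measurable R := by
      refine ((((measurable_cosLaplace hw.measurable (l n)).comp
        (show Measurable fun y : ℝ => (y - x) / h n by fun_prop)).sub ?_)).const_mul _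
      fun_prop
    obtain ⟨hRint, hRle1⟩ := integral_abs_sqrt_mul_average_sub_le hindep hident hRm
      ((abs_nonneg _).trans (hRbd 0)) hRbd hn0
    have hRle2 := hRle1.trans (sqrt_integral_sq_le_of_abs_le (G := fun ω => X 0 ω - x)
      (c := |c n| * L' n / h n) (by positivity) hXx fun ω => hRle _)
    have hdec := normalized_plugIn_sub_cos_sum_eq hident hσ hw.measurable (hintw _ _) hw.symm
      hw.support_subset hn hεn hn0 hQ hQint ha (c := c n) (L := L n) rfl hR
    have hQc : Integrable (fun ω => a * (Q ω - ∫ ω', Q ω' ∂μ)) μ :=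
      (hQint.sub (integrable_const _)).const_mul _
    have hsum := hRint.add hQc
    refine ⟨hsum.congr (ae_of_all _ fun ω => (hdec ω).symm), ?_⟩
    have hcongr : ∫ ω, |((fun (n : ℕ) (ω : Ω) =>
        √n / (h n ^ (1 + 2 * α) * Real.exp (σ ^ 2 / (2 * h n ^ 2))) *
          (plugInDensityEst σ φw φk X (h n) (g n) (ε n) n x ω -
            ∫ ω', plugInDensityEst σ φw φk X (h n) (g n) (ε n) n x ω' ∂μ)) -
        fun (n : ℕ) ω => (√n)⁻¹ * ∑ k ∈ Finset.range n, ψ n (X k ω)) n ω| ∂μ ≤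
        ∫ ω, (|√n * (1 / (n : ℝ) * ∑ j ∈ Finset.range n, R (X j ω) - ∫ ω', R (X 0 ω') ∂μ)| +
          |a * (Q ω - ∫ ω', Q ω' ∂μ)|) ∂μ := by
      refine integral_mono_of_nonneg (ae_of_all _ fun ω => abs_nonneg _) (hRint.abs.add hQc.abs)
        (ae_of_all _ fun ω => ?_)
      exact (congrArg abs (hdec ω)).le.trans (abs_add_le _ _)
    refine hcongr.trans ?_
    rw [integral_add hRint.abs hQc.abs]
    refine add_le_add hRle2 ?_
    simp only [abs_mul a, abs_of_nonneg ha0]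
    rw [integral_const_mul]
    have h1 := (integral_abs_sub_integral_le hQint).trans (mul_le_mul_of_nonneg_left hQle two_pos.le)
    refine (mul_le_mul_of_nonneg_left h1 ha0).trans (le_of_eq ?_)
    have hnorm := normalization_mul_eq hσ hn α n
    rw [← ha] at hnorm
    simp only [hN, hl_def, hκ]
    rw [← hnorm]
    ring
  · have h1 := (hrem.mul_const D).add (hplug.const_mul 2)
    simpa using h1
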